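/- Consider $m$-mode lossy linear-optical networks built from the following element: a lossless two-mode linear-optical transformation (a ``beamsplitter'', given by an arbitrary $2\times 2$ unitary) acting on two distinct modes, preceded by one loss element in each of its two input arms. Every loss element acts on a single mode and transmits each photon with the same probability $\eta\in[0,1]$: it is the channel obtained by coupling the mode to an unobserved vacuum mode with transmission probability $\eta$. A network $\mathcal N$ is a finite sequence of components on $m$ modes, and its channel $\Lambda_{\mathcal N}$ on the states of the $m$-mode bosonic Fock space is the composition of the channels of its components. A path enters in some input mode, may leave each beamsplitter that it meets through either of its two output arms, and ends in some output mode. Let $\mathcal N$ be an $m$-mode network ($m\ge 1$) constructed from such elements, and let $s$ be the smallest number of beamsplitters traversed by any path from an input mode to an output mode. Let $\Lambda_{\eta'}$ denote uniform loss, that is, one loss element of transmissivity $\eta'$ in each of the $m$ modes. Then there is a network $\tilde{\mathcal N}$, depending only on the arrangement of the components of $\mathcal N$ (not on $\eta$ or on the values of the unitaries), such that for every choice of the unitaries and every $\eta\in[0,1]$ $$\Lambda_{\mathcal N}=\Lambda_{\tilde{\mathcal N}}\circ\Lambda_{\eta^s}.$$ The network $\tilde{\mathcal N}$ has the same beamsplitters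 in the same order as $\mathcal N$ and exactly $sm$ fewer loss elements, all of transmissivity $\eta$. It is what remains when loss elements are moved through $\mathcal N$ (past components acting on other modes, past each other, and in pairs from the two output arms of a beamsplitter to its two input arms) until there are $s$ uniform layers of losses, each with one loss element in every mode, at the input, and these $s$ layers are removed. Moreover, one fixed algorithm computes the description of $\tilde{\mathcal N}$ from the description of $\mathcal N$ in time polynomial in $m$ and the number of components of $\mathcal N$ (on a random access machine with unit-cost additions and subtractions, where a description lists the number of modes and, for each component, its kind, its modes and, for a beamsplitter, the name of its unitary). -/

import Mathlib

open scoped ComplexOrder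

namespace LossyOptics

/-! ### Bosonic states

The Fock space of `m` bosonic modes has the orthonormal basis of occupation number states `|n⟩`,
`n : Fin m →₀ ℕ`. Operators are given by their matrix elements in that basis. -/

/-- The operator with matrix elements `⟨p| ρ |q⟩ = ρ p q` in the occupation number basis. -/
abbrev FockOp (m : ℕ) : Type := Matrix (Fin m →₀ ℕ) (Fin m →₀ ℕ) ℂ

/-- Density operators: positive semidefinite with trace one. The number of particles need neither be
bounded nor definite. -/
def IsState {m : ℕ} (ρ : FockOp m) : Prop :=
  ρ.PosSemidef ∧ HasSum (fun n => ρ n n) 1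

/-! ### Loss elements -/

/-- The amplitude `⟨n| K_k |n + k e_i⟩ = √(C(n_i + k, k) η^{n_i} (1 - η)^k)` of the Kraus operator
`K_k` "exactly `k` photons of mode `i` are lost" of a loss element in mode `i`; all other matrix
elements of `K_k` vanish. -/
noncomputable def lossAmplitude {m : ℕ} (η : ℝ) (i : Fin m) (k : ℕ) (n : Fin m →₀ ℕ) : ℂ :=
  ((Real.sqrt (((n i + k).choose k : ℝ) * η ^ (n i) * (1 - η) ^ k) : ℝ) : ℂ)

/-- The channel `ρ ↦ ∑ₖ K_k ρ K_k†` of one loss element with transmissivity (single-photon survival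
probability) `η` in mode `i`: the mode is coupled to an unobserved mode in the vacuum by a
beamsplitter that transmits each photon with probability `η`. -/
noncomputable def lossChannel {m : ℕ} (η : ℝ) (i : Fin m) (ρ : FockOp m) : FockOp m :=
  fun p q => ∑' k : ℕ, lossAmplitude η i k p *
    ρ (p + Finsupp.single i k) (q + Finsupp.single i k) * star (lossAmplitude η i k q)

/-- Uniform losses with transmissivity `η`: a loss element with transmissivity `η` in every mode. -/
noncomputable def uniformLoss {m : ℕ} (η : ℝ) (ρ : FockOp m) : FockOp m :=
  (List.finRange m).foldl (fun σ i => lossChannel η i σ) ρ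

/-! ### Lossless two-mode transformations -/

/-- The image of the creation operator of mode `a` under the transformation of the modes `i`, `j`
given by the `2 × 2` matrix `V`: `a†_i ↦ V₀₀ a†_i + V₀₁ a†_j`, `a†_j ↦ V₁₀ a†_i + V₁₁ a†_j`, and
`a†_k ↦ a†_k` for the other modes. Creation operators commute; they are the variables of a
polynomial ring. -/
noncomputable def creationImage {m : ℕ} (V : Matrix (Fin 2) (Fin 2) ℂ) (i j a : Fin m) :
    MvPolynomial (Fin m) ℂ :=
  if a = i then MvPolynomial.C (V 0 0) * MvPolynomial.X i + MvPolynomial.C (V 0 1) * MvPolynomial.X j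
  else if a = j then
    MvPolynomial.C (V 1 0) * MvPolynomial.X i + MvPolynomial.C (V 1 1) * MvPolynomial.X j
  else MvPolynomial.X a

/-- `n! = ∏ₐ nₐ!`. -/
def occFactorial {m : ℕ} (n : Fin m →₀ ℕ) : ℕ := ∏ a, (n a).factorial

/-- The matrix element `⟨p| φ(V) |n⟩` of the operator on Fock space induced by `V`. Since
`|n⟩ = (n!)^{-1/2} ∏ₐ (a†_a)^{nₐ} |0⟩`, the vector `φ(V)|n⟩` is obtained by substituting the images of
the creation operators, and a monomial with exponents `p` contributes `(p!)^{1/2} |p⟩`. -/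
noncomputable def gateAmplitude {m : ℕ} (V : Matrix (Fin 2) (Fin 2) ℂ) (i j : Fin m)
    (p n : Fin m →₀ ℕ) : ℂ :=
  ((Real.sqrt ((occFactorial p : ℝ) / (occFactorial n : ℝ)) : ℝ) : ℂ) *
    MvPolynomial.coeff p (∏ a, creationImage V i j a ^ n a)

/-- The channel `ρ ↦ φ(V) ρ φ(V)†`. The sums are over the occupation numbers with as many photons as
`p` and `q`, because `φ(V)` preserves the number of photons (all other amplitudes vanish). -/
noncomputable def gateChannel {m : ℕ} (V : Matrix (Fin 2) (Fin 2) ℂ) (i j : Fin m)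
    (ρ : FockOp m) : FockOp m :=
  fun p q =>
    ∑ n ∈ Finset.finsuppAntidiag Finset.univ p.degree,
      ∑ n' ∈ Finset.finsuppAntidiag Finset.univ q.degree,
        gateAmplitude V i j p n * ρ n n' * star (gateAmplitude V i j q n')

/-! ### Networks -/

/-- A lossless two-mode element ("beamsplitter") acting on two distinct modes. The number `gate` is
the name of its `2 × 2` unitary matrix in a table of unitaries. -/
structure Beamsplitter (m : ℕ) where
  fst : Fin m
  snd : Fin m
  ne : fst ≠ snd
  gate : ℕ

/-- The components of a lossy network. -/
inductive Component (m : ℕ) : Type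
  | loss (i : Fin m) : Component m
  | split (b : Beamsplitter m) : Component m

/-- A network on `m` modes: its components in the order in which the light meets them. -/
abbrev Network (m : ℕ) : Type := List (Component m)

/-- The lossy building block: one loss element in each of the two input arms of a beamsplitter. -/
def block {m : ℕ} (b : Beamsplitter m) : Network m :=
  [Component.loss b.fst, Component.loss b.snd, Component.split b]

/-- The network constructed out of the lossy building blocks with the given beamsplitters. -/
def lossyNetwork {m : ℕ} (bs : List (Beamsplitter m)) : Network m := bs.flatMap block

/-- The channel of a component, with the table `U` of unitaries and loss elements of
transmissivity `η`. -/
noncomputable def Component.channel {m : ℕ} (U : ℕ → Matrix.unitaryGroup (Fin 2) ℂ) (η : ℝ) :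
    Component m → FockOp m → FockOp m
  | Component.loss i, ρ => lossChannel η i ρ
  | Component.split b, ρ => gateChannel (U b.gate : Matrix (Fin 2) (Fin 2) ℂ) b.fst b.snd ρ

/-- The channel `Λ_N` of a network: the composition of the channels of its components. -/
noncomputable def networkChannel {m : ℕ} (U : ℕ → Matrix.unitaryGroup (Fin 2) ℂ) (η : ℝ)
    (N : Network m) (ρ : FockOp m) : FockOp m :=
  N.foldl (fun σ c => c.channel U η σ) ρ

/-- `PathCrosses N a b k`: some path from input mode `a` to output mode `b` of `N` traverses exactly
`k` beamsplitters. A path that enters a beamsplitter may leave it by either of its two modes. -/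
inductive PathCrosses {m : ℕ} : Network m → Fin m → Fin m → ℕ → Prop
  | nil (a : Fin m) : PathCrosses [] a a 0
  | loss (i : Fin m) {N : Network m} {a b : Fin m} {k : ℕ} :
      PathCrosses N a b k → PathCrosses (Component.loss i :: N) a b k
  | pass (e : Beamsplitter m) {N : Network m} {a b : Fin m} {k : ℕ} :
      a ≠ e.fst → a ≠ e.snd → PathCrosses N a b k → PathCrosses (Component.split e :: N) a b k
  | cross (e : Beamsplitter m) {N : Network m} {a a' b : Fin m} {k : ℕ} :
      (a = e.fst ∨ a = e.snd) → (a' = e.fst ∨ a' = e.snd) →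
      PathCrosses N a' b k → PathCrosses (Component.split e :: N) a b (k + 1)

/-- The beamsplitters of a network, in order. -/
def beamsplitters {m : ℕ} (N : Network m) : List (Beamsplitter m) :=
  N.filterMap fun
    | Component.loss _ => none
    | Component.split b => some b

/-- The number of loss elements of a network. -/
def lossCount {m : ℕ} (N : Network m) : ℕ :=
  N.countP fun
    | Component.loss _ => true
    | Component.split _ => false

/-- One uniform layer of losses: one loss element in each mode. -/
def uniformLayer (m : ℕ) : Network m := (List.finRange m).map Component.loss

/-- One step of moving loss elements through a network. The rules `comm`, `left` and `right` only
exchange components without a common beamsplitter, which does not change the network as a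
diagram; `pull` moves one loss element from each of the two output arms of a beamsplitter to its two
input arms. -/
inductive Move {m : ℕ} : Network m → Network m → Prop
  | comm (A B : Network m) (i j : Fin m) :
      Move (A ++ [Component.loss i, Component.loss j] ++ B)
        (A ++ [Component.loss j, Component.loss i] ++ B)
  | left (A B : Network m) (b : Beamsplitter m) (i : Fin m) : i ≠ b.fst → i ≠ b.snd →
      Move (A ++ [Component.split b, Component.loss i] ++ B)
        (A ++ [Component.loss i, Component.split b] ++ B)
  | right (A B : Network m) (b : Beamsplitter m) (i : Fin m) : i ≠ b.fst → i ≠ b.snd →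
      Move (A ++ [Component.loss i, Component.split b] ++ B)
        (A ++ [Component.split b, Component.loss i] ++ B)
  | pull (A B : Network m) (b : Beamsplitter m) :
      Move (A ++ [Component.split b, Component.loss b.fst, Component.loss b.snd] ++ B)
        (A ++ [Component.loss b.fst, Component.loss b.snd, Component.split b] ++ B)

/-- `PullsOut N s N'`: moving loss elements through `N` yields `s` uniform layers of losses at the
input followed by `N'`; that is, `N'` is left over when `s` uniform layers of losses are pulled out of
`N` and removed. -/
def PullsOut {m : ℕ} (N : Network m) (s : ℕ) (N' : Network m) : Prop :=
  Relation.ReflTransGen Move N ((List.replicate s (uniformLayer m)).flatten ++ N')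

/-! ### Efficient computation

A random access machine with additions and subtractions, programmed in a structured language. It has
registers and arrays that hold natural numbers. Every arithmetic operation, memory access,
assignment and test costs one step. -/

/-- The contents of the memory: register `r` holds `reg r`, cell `k` of array `A` holds `arr A k`. -/
structure Store where
  reg : ℕ → ℕ
  arr : ℕ → ℕ → ℕ

/-- Expressions. -/
inductive Expr : Type
  | const (n : ℕ) : Expr
  | var (r : ℕ) : Expr
  | add (e₁ e₂ : Expr) : Expr
  | sub (e₁ e₂ : Expr) : Expr
  | get (A : ℕ) (e : Expr) : Expr

/-- The value of an expression; subtraction is truncated at `0`. -/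
def Expr.eval (σ : Store) : Expr → ℕ
  | Expr.const n => n
  | Expr.var r => σ.reg r
  | Expr.add e₁ e₂ => e₁.eval σ + e₂.eval σ
  | Expr.sub e₁ e₂ => e₁.eval σ - e₂.eval σ
  | Expr.get A e => σ.arr A (e.eval σ)

/-- The number of steps for the evaluation of an expression. -/
def Expr.cost : Expr → ℕ
  | Expr.const _ => 1
  | Expr.var _ => 1
  | Expr.add e₁ e₂ => e₁.cost + e₂.cost + 1
  | Expr.sub e₁ e₂ => e₁.cost + e₂.cost + 1
  | Expr.get _ e => e.cost + 1

/-- Programs: `set r e` is `reg r := e`, `put A e₁ e₂` is `arr A e₁ := e₂`, `ite e₁ e₂ P Q` is "if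
`e₁ < e₂` then `P` else `Q`", and `loop e₁ e₂ P` is "while `e₁ < e₂` do `P`". -/
inductive Program : Type
  | skip : Program
  | set (r : ℕ) (e : Expr) : Program
  | put (A : ℕ) (e₁ e₂ : Expr) : Program
  | seq (P Q : Program) : Program
  | ite (e₁ e₂ : Expr) (P Q : Program) : Program
  | loop (e₁ e₂ : Expr) (P : Program) : Program

/-- `Runs P σ σ' t`: started with memory `σ`, the program `P` halts after `t` steps with memory
`σ'`. -/
inductive Runs : Program → Store → Store → ℕ → Prop
  | skip (σ : Store) : Runs Program.skip σ σ 1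
  | set (r : ℕ) (e : Expr) (σ : Store) :
      Runs (Program.set r e) σ { σ with reg := Function.update σ.reg r (e.eval σ) } (e.cost + 1)
  | put (A : ℕ) (e₁ e₂ : Expr) (σ : Store) :
      Runs (Program.put A e₁ e₂) σ
        { σ with arr :=
            Function.update σ.arr A (Function.update (σ.arr A) (e₁.eval σ) (e₂.eval σ)) }
        (e₁.cost + e₂.cost + 1)
  | seq {P Q : Program} {σ σ' σ'' : Store} {t t' : ℕ} :
      Runs P σ σ' t → Runs Q σ' σ'' t' → Runs (Program.seq P Q) σ σ'' (t + t')
  | ite_true {e₁ e₂ : Expr} {P Q : Program} {σ σ' : Store} {t : ℕ} :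
      e₁.eval σ < e₂.eval σ → Runs P σ σ' t →
      Runs (Program.ite e₁ e₂ P Q) σ σ' (e₁.cost + e₂.cost + 1 + t)
  | ite_false {e₁ e₂ : Expr} {P Q : Program} {σ σ' : Store} {t : ℕ} :
      ¬ e₁.eval σ < e₂.eval σ → Runs Q σ σ' t →
      Runs (Program.ite e₁ e₂ P Q) σ σ' (e₁.cost + e₂.cost + 1 + t)
  | loop_true {e₁ e₂ : Expr} {P : Program} {σ σ' σ'' : Store} {t t' : ℕ} :
      e₁.eval σ < e₂.eval σ → Runs P σ σ' t → Runs (Program.loop e₁ e₂ P) σ' σ'' t' →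
      Runs (Program.loop e₁ e₂ P) σ σ'' (e₁.cost + e₂.cost + 1 + t + t')
  | loop_false {e₁ e₂ : Expr} {P : Program} {σ : Store} :
      ¬ e₁.eval σ < e₂.eval σ → Runs (Program.loop e₁ e₂ P) σ σ (e₁.cost + e₂.cost + 1)

/-- The initial memory: the input is in array `0`, its length is in register `0`, and everything else
is `0`. -/
def initialStore (input : List ℕ) : Store where
  reg := fun r => if r = 0 then input.length else 0
  arr := fun A k => if A = 0 then input.getD k 0 else 0

/-- On the given input, `P` halts after at most `t` steps with the output in array `1` and the length
of the output in register `1`. -/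
def ComputesWithin (P : Program) (input output : List ℕ) (t : ℕ) : Prop :=
  ∃ (σ : Store) (t' : ℕ), t' ≤ t ∧ Runs P (initialStore input) σ t' ∧
    σ.reg 1 = output.length ∧ ∀ k < output.length, σ.arr 1 k = output.getD k 0

/-- The description of a component: its kind and its modes, and the name of the unitary of a
beamsplitter. -/
def Component.words {m : ℕ} : Component m → List ℕ
  | Component.loss i => [0, (i : ℕ)]
  | Component.split b => [1, (b.fst : ℕ), (b.snd : ℕ), b.gate]

/-- The description of a network: the number of modes and the list of the components. -/
def describe {m : ℕ} (N : Network m) : List ℕ := m :: N.flatMap Component.words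

end LossyOptics

/-!
A loss element is the exponential of the jump operator `ρ ↦ a ρ a†` of its mode, followed by the
damping of the state in which no photon is lost. With equal rates in both modes of a beamsplitter,
the sum of the two jump operators and the damping commute with its unitary. This is most transparent
when the lost photons are counted: a network then becomes a power series of operations, whose `d`-th
coefficient describes the loss of `d` photons, all commutations are identities of power series, and
the channel, the sum of the coefficients, is the same for networks with the same series.

Moving losses greedily to the input leaves in every mode as many losses as there are beamsplitters
on the shortest path that starts there: at a beamsplitter the two output arms can pass on the
minimum of their numbers, to which the beamsplitter adds its own loss. So the minimum `s` over all
modes is the number of full layers at the input. A single pass from the last beamsplitter to the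
first computes these numbers and the surplus that stays behind in each output arm.
-/

namespace LossyOptics

section SesquilinearForm

variable {ι κ ν : Type*}

/-- The matrix element `⟨u| ρ |v⟩` of a possibly infinite matrix between finitely supported vectors,
as a sesquilinear form. -/
noncomputable def matrixElement (ρ : Matrix ι ι ℂ) : (ι →₀ ℂ) →ₗ⋆[ℂ] (ι →₀ ℂ) →ₗ[ℂ] ℂ :=
  LinearMap.mk₂'ₛₗ (starRingEnd ℂ) (RingHom.id ℂ)
    (fun u v => u.sum fun n x => v.sum fun n' y => star x * ρ n n' * y)
    (fun u₁ u₂ v => Finsupp.sum_add_index' (by simp) fun n x y => by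
      simp only [star_add, add_mul, Finsupp.sum_add])
    (fun c u v => by
      rw [Finsupp.sum_smul_index' (by simp), smul_eq_mul, Finsupp.mul_sum]
      congr! with _ x
      simp only [Finsupp.mul_sum, smul_eq_mul, star_mul', starRingEnd_apply, mul_assoc])
    (fun u v₁ v₂ => by
      rw [← Finsupp.sum_add]
      congr! with n x
      exact Finsupp.sum_add_index' (by simp) fun n y z => by rw [mul_add])
    (fun c u v => by
      rw [RingHom.id_apply, smul_eq_mul, Finsupp.mul_sum]
      congr! with _ x
      rw [Finsupp.sum_smul_index' (by simp), Finsupp.mul_sum]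
      simp only [smul_eq_mul, mul_left_comm])

theorem matrixElement_apply (ρ : Matrix ι ι ℂ) (u v : ι →₀ ℂ) :
    matrixElement ρ u v = u.sum fun n x => v.sum fun n' y => star x * ρ n n' * y := rfl

theorem matrixElement_single_single (ρ : Matrix ι ι ℂ) (p q : ι) (x y : ℂ) :
    matrixElement ρ (.single p x) (.single q y) = star x * ρ p q * y := by
  simp [matrixElement_apply]

theorem continuous_matrixElement (u v : ι →₀ ℂ) :
    Continuous fun ρ : Matrix ι ι ℂ => matrixElement ρ u v := by
  simp only [matrixElement_apply, Finsupp.sum]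
  fun_prop

/-- The map `ρ ↦ B† ρ C`, where `B` and `C` need only be defined on finitely supported vectors. In
the Kraus form `K ρ K†` of a channel this is used with `B = C = K†`. -/
noncomputable def sandwich (B C : (ι →₀ ℂ) →ₗ[ℂ] (κ →₀ ℂ)) : Matrix κ κ ℂ →ₗ[ℂ] Matrix ι ι ℂ where
  toFun ρ := Matrix.of fun p q => matrixElement ρ (B (.single p 1)) (C (.single q 1))
  map_add' ρ σ := by
    ext p q
    simp [matrixElement_apply, mul_add, add_mul, Finsupp.sum_add]
  map_smul' c ρ := by
    ext p q
    simp [matrixElement_apply, Finsupp.mul_sum, mul_left_comm, mul_assoc]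

theorem sandwich_apply (B C : (ι →₀ ℂ) →ₗ[ℂ] (κ →₀ ℂ)) (ρ : Matrix κ κ ℂ) (p q : ι) :
    sandwich B C ρ p q = matrixElement ρ (B (.single p 1)) (C (.single q 1)) := rfl

theorem continuous_sandwich (B C : (ι →₀ ℂ) →ₗ[ℂ] (κ →₀ ℂ)) : Continuous (sandwich B C) :=
  continuous_matrix fun _ _ => continuous_matrixElement _ _

theorem matrixElement_sandwich (B C : (ι →₀ ℂ) →ₗ[ℂ] (κ →₀ ℂ)) (ρ : Matrix κ κ ℂ)
    (u v : ι →₀ ℂ) : matrixElement (sandwich B C ρ) u v = matrixElement ρ (B u) (C v) := by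
  induction u using Finsupp.induction_linear with
  | zero => simp
  | add u₁ u₂ h₁ h₂ => simp only [map_add, LinearMap.add_apply, h₁, h₂]
  | single p x =>
    induction v using Finsupp.induction_linear with
    | zero => simp
    | add v₁ v₂ h₁ h₂ => simp only [map_add, h₁, h₂]
    | single q y =>
      rw [matrixElement_single_single, sandwich_apply, ← mul_one x, ← mul_one y,
        ← smul_eq_mul (a := x), ← smul_eq_mul (a := y), ← Finsupp.smul_single,
        ← Finsupp.smul_single]
      simp only [map_smul, map_smulₛₗ, LinearMap.smul_apply, smul_eq_mul, starRingEnd_apply,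
        mul_one]
      ring

theorem sandwich_sandwich (B C : (ι →₀ ℂ) →ₗ[ℂ] (κ →₀ ℂ)) (B' C' : (κ →₀ ℂ) →ₗ[ℂ] (ν →₀ ℂ))
    (ρ : Matrix ν ν ℂ) :
    sandwich B C (sandwich B' C' ρ) = sandwich (B' ∘ₗ B) (C' ∘ₗ C) ρ := by
  ext p q
  simp only [sandwich_apply, matrixElement_sandwich, LinearMap.comp_apply]

theorem star_matrixElement {ρ : Matrix ι ι ℂ} (hρ : ρ.IsHermitian) (u v : ι →₀ ℂ) :
    star (matrixElement ρ u v) = matrixElement ρ v u := by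
  rw [matrixElement_apply, matrixElement_apply, Finsupp.sum_comm]
  simp only [Finsupp.sum, star_sum, star_mul', star_star, hρ.apply]
  congr! 2
  ring

theorem posSemidef_sandwich (B : (ι →₀ ℂ) →ₗ[ℂ] (κ →₀ ℂ)) {ρ : Matrix κ κ ℂ}
    (hρ : ρ.PosSemidef) : (sandwich B B ρ).PosSemidef := by
  refine ⟨?_, fun u => ?_⟩
  · ext p q
    exact star_matrixElement hρ.1 _ _
  · change 0 ≤ matrixElement (sandwich B B ρ) u u
    rw [matrixElement_sandwich]
    exact hρ.2 (B u)

end SesquilinearForm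

section LinearOptics

open Finsupp (single)

variable {m : ℕ}

/-- The finitely supported vectors of the Fock space. -/
abbrev FockVec (m : ℕ) : Type := (Fin m →₀ ℕ) →₀ ℂ

/-- The creation operator of mode `c`. -/
noncomputable def create (c : Fin m) : FockVec m →ₗ[ℂ] FockVec m :=
  Finsupp.linearCombination ℂ fun n => single (n + single c 1) ((√(n c + 1) : ℝ) : ℂ)

theorem create_single (c : Fin m) (n : Fin m →₀ ℕ) (x : ℂ) :
    create c (single n x) = single (n + single c 1) (x * (√(n c + 1) : ℝ)) := by
  simp [create]

theorem create_comp_create_comm (b c : Fin m) : create b ∘ₗ create c = create c ∘ₗ create b := by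
  rcases eq_or_ne b c with rfl | hbc
  · rfl
  ext1 n
  refine LinearMap.ext_ring ?_
  simp [create_single, hbc, hbc.symm, add_right_comm, mul_comm]

theorem mem_finsuppAntidiag_univ {σ : Type*} [Fintype σ] [DecidableEq σ] (n : σ →₀ ℕ) (d : ℕ) :
    n ∈ Finset.finsuppAntidiag Finset.univ d ↔ n.degree = d := by
  simp [Finset.mem_finsuppAntidiag, Finsupp.degree_eq_sum]

theorem sum_finsuppAntidiag_succ {σ R : Type*} [Fintype σ] [DecidableEq σ] [AddCommMonoid R]
    (N : ℕ) (c : σ) (f : (σ →₀ ℕ) → R) (hf : ∀ n, n c = 0 → f n = 0) :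
    ∑ n ∈ Finset.finsuppAntidiag Finset.univ (N + 1), f n =
      ∑ n ∈ Finset.finsuppAntidiag Finset.univ N, f (n + single c 1) := by
  symm
  refine Finset.sum_of_injOn (· + single c 1) (fun a _ b _ => add_right_cancel) ?_ ?_ fun _ _ => rfl
  · intro n hn
    rw [Finset.mem_coe, mem_finsuppAntidiag_univ] at hn ⊢
    rw [map_add, hn, Finsupp.degree_single]
  · intro n hn hn'
    refine hf n (by_contra fun hc => hn' ⟨n - single c 1, ?_, ?_⟩)
    · have hle : single c 1 ≤ n := Finsupp.single_le_iff.2 (Nat.one_le_iff_ne_zero.2 hc)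
      have := congrArg Finsupp.degree (tsub_add_cancel_of_le hle)
      simp only [map_add, Finsupp.degree_single, Finset.mem_coe, mem_finsuppAntidiag_univ]
        at this hn ⊢
      omega
    · exact tsub_add_cancel_of_le (Finsupp.single_le_iff.2 (Nat.one_le_iff_ne_zero.2 hc))

theorem occFactorial_add_single (n : Fin m →₀ ℕ) (c : Fin m) :
    occFactorial (n + single c 1) = (n c + 1) * occFactorial n := by
  simp only [occFactorial, ← Finset.mul_prod_erase _ _ (Finset.mem_univ c), ← mul_assoc]
  congr 1
  · simp [Nat.factorial_succ]
  · exact Finset.prod_congr rfl fun a ha => by simp [Finset.ne_of_mem_erase ha]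

/-- The substitution `a†_a ↦ ∑ c, M a c a†_c` of the creation operators by a linear-optical
transformation of all the modes. -/
noncomputable def modeSubst (M : Matrix (Fin m) (Fin m) ℂ) :
    MvPolynomial (Fin m) ℂ →ₐ[ℂ] MvPolynomial (Fin m) ℂ :=
  MvPolynomial.aeval fun a => ∑ c, MvPolynomial.C (M a c) * MvPolynomial.X c

/-- The matrix element `⟨p| φ(M) |n⟩` of the operator induced on Fock space by a linear-optical
transformation `M` of all the modes. -/
noncomputable def opticalAmplitude (M : Matrix (Fin m) (Fin m) ℂ) (p n : Fin m →₀ ℕ) : ℂ :=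
  (√((occFactorial p : ℝ) / occFactorial n) : ℝ) *
    MvPolynomial.coeff p (modeSubst M (MvPolynomial.monomial n 1))

theorem pderiv_aeval {σ τ R : Type*} [Fintype σ] [CommSemiring R] (g : σ → MvPolynomial τ R) (c : τ)
    (f : MvPolynomial σ R) :
    MvPolynomial.pderiv c (MvPolynomial.aeval g f) =
      ∑ b, MvPolynomial.aeval g (MvPolynomial.pderiv b f) * MvPolynomial.pderiv c (g b) := by
  classical
  induction f using MvPolynomial.induction_on with
  | C r => simp
  | add f₁ f₂ h₁ h₂ => simp only [map_add, h₁, h₂, add_mul, Finset.sum_add_distrib]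
  | mul_X f a h =>
    have hX (b : σ) : MvPolynomial.pderiv b (f * MvPolynomial.X a) =
        (if a = b then f else 0) + MvPolynomial.X a * MvPolynomial.pderiv b f := by
      simp [Derivation.leibniz, MvPolynomial.pderiv_X, Pi.single_apply]
    simp only [hX, map_add, map_mul, MvPolynomial.aeval_X, add_mul, Finset.sum_add_distrib,
      Derivation.leibniz, h, smul_eq_mul, Finset.mul_sum, apply_ite (MvPolynomial.aeval g),
      map_zero, ite_mul, zero_mul, Finset.sum_ite_eq, Finset.mem_univ, if_true, mul_assoc]

theorem pderiv_modeSubst_monomial (M : Matrix (Fin m) (Fin m) ℂ) (c : Fin m) (n : Fin m →₀ ℕ) :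
    MvPolynomial.pderiv c (modeSubst M (MvPolynomial.monomial n 1)) =
      ∑ b, MvPolynomial.C (M b c * n b) *
        modeSubst M (MvPolynomial.monomial (n - single b 1) 1) := by
  rw [modeSubst, pderiv_aeval]
  refine Finset.sum_congr rfl fun b _ => ?_
  have hrow : MvPolynomial.pderiv c (∑ d, MvPolynomial.C (M b d) * MvPolynomial.X d) =
      MvPolynomial.C (M b c) := by
    simp [MvPolynomial.pderiv_X, Pi.single_apply]
  rw [hrow, MvPolynomial.pderiv_monomial, one_mul, ← mul_one (n b : ℂ),
    ← MvPolynomial.C_mul_monomial, map_mul, MvPolynomial.algHom_C, mul_one,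
    MvPolynomial.algebraMap_eq, map_mul]
  ring

theorem sqrt_mul_sqrt_occFactorial_add_single (p n : Fin m →₀ ℕ) (c : Fin m) :
    √(p c + 1) * √((occFactorial (p + single c 1) : ℝ) / occFactorial n) =
      √((occFactorial p : ℝ) / occFactorial n) * (p c + 1) := by
  rw [occFactorial_add_single, Nat.cast_mul, mul_div_assoc, Real.sqrt_mul (by positivity)]
  push_cast
  rw [← mul_assoc, Real.mul_self_sqrt (by positivity), mul_comm]

theorem sqrt_occFactorial_mul (p n : Fin m →₀ ℕ) (b : Fin m) :
    √((occFactorial p : ℝ) / occFactorial n) * n b =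
      √(n b) * √((occFactorial p : ℝ) / occFactorial (n - single b 1)) := by
  rcases (n b).eq_zero_or_pos with hb | hb
  · simp [hb]
  obtain ⟨k, rfl⟩ : ∃ k, n = k + single b 1 :=
    ⟨_, (tsub_add_cancel_of_le (Finsupp.single_le_iff.2 hb)).symm⟩
  have hx : (0 : ℝ) < (k b + 1 : ℕ) := by positivity
  rw [add_tsub_cancel_right, occFactorial_add_single, Finsupp.add_apply, Finsupp.single_eq_same,
    Nat.cast_mul, mul_comm ((k b + 1 : ℕ) : ℝ) (occFactorial k : ℝ), ← div_div,
    Real.sqrt_div' _ hx.le, div_mul_eq_mul_div, mul_div_assoc, Real.div_sqrt, mul_comm]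

theorem sqrt_mul_opticalAmplitude_add_single (M : Matrix (Fin m) (Fin m) ℂ) (c : Fin m)
    (p n : Fin m →₀ ℕ) :
    (√(p c + 1) : ℝ) * opticalAmplitude M (p + single c 1) n =
      ∑ b, M b c * ((√(n b) : ℝ) * opticalAmplitude M p (n - single b 1)) := by
  have hraise := congrArg (fun x : ℝ => (x : ℂ)) (sqrt_mul_sqrt_occFactorial_add_single p n c)
  push_cast at hraise
  calc (√(p c + 1) : ℝ) * opticalAmplitude M (p + single c 1) n
      = (√((occFactorial p : ℝ) / occFactorial n) : ℝ) * MvPolynomial.coeff p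
          (MvPolynomial.pderiv c (modeSubst M (MvPolynomial.monomial n 1))) := by
        rw [opticalAmplitude, MvPolynomial.coeff_pderiv, ← mul_assoc, hraise]
        ring
    _ = ∑ b, M b c * ((√((occFactorial p : ℝ) / occFactorial n) : ℝ) * n b) *
          MvPolynomial.coeff p (modeSubst M (MvPolynomial.monomial (n - single b 1) 1)) := by
        simp only [pderiv_modeSubst_monomial, MvPolynomial.coeff_sum, MvPolynomial.coeff_C_mul,
          Finset.mul_sum]
        exact Finset.sum_congr rfl fun b _ => by ring
    _ = _ := Finset.sum_congr rfl fun b _ => by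
        have hlower := congrArg (fun x : ℝ => (x : ℂ)) (sqrt_occFactorial_mul p n b)
        push_cast at hlower
        rw [hlower, opticalAmplitude]
        ring

/-- The adjoint `φ(M)†`, which maps finitely supported vectors to finitely supported vectors because
it preserves the number of photons. -/
noncomputable def opticalAdjoint (M : Matrix (Fin m) (Fin m) ℂ) : FockVec m →ₗ[ℂ] FockVec m :=
  Finsupp.linearCombination ℂ fun p =>
    ∑ n ∈ Finset.finsuppAntidiag Finset.univ p.degree, single n (star (opticalAmplitude M p n))

theorem opticalAdjoint_single (M : Matrix (Fin m) (Fin m) ℂ) (p : Fin m →₀ ℕ) :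
    opticalAdjoint M (single p 1) = ∑ n ∈ Finset.finsuppAntidiag Finset.univ p.degree,
      single n (star (opticalAmplitude M p n)) := by
  simp [opticalAdjoint]

theorem opticalAdjoint_comp_create (M : Matrix (Fin m) (Fin m) ℂ) (c : Fin m) :
    opticalAdjoint M ∘ₗ create c = ∑ b, star (M b c) • create b ∘ₗ opticalAdjoint M := by
  ext1 p
  refine LinearMap.ext_ring ?_
  have hcoeff (n : Fin m →₀ ℕ) : (√(p c + 1) : ℝ) * star (opticalAmplitude M (p + single c 1) n) =
      ∑ b, star (M b c) * ((√(n b) : ℝ) * star (opticalAmplitude M p (n - single b 1))) := by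
    simpa [mul_comm] using congrArg star (sqrt_mul_opticalAmplitude_add_single M c p n)
  calc opticalAdjoint M (create c (single p 1))
      = ∑ n ∈ Finset.finsuppAntidiag Finset.univ (p.degree + 1),
          single n ((√(p c + 1) : ℝ) * star (opticalAmplitude M (p + single c 1) n)) := by
        rw [create_single, mul_comm, ← smul_eq_mul, ← Finsupp.smul_single, map_smul,
          opticalAdjoint_single, map_add, Finsupp.degree_single, Finset.smul_sum]
        simp only [Finsupp.smul_single, smul_eq_mul]
    _ = ∑ b, ∑ n ∈ Finset.finsuppAntidiag Finset.univ (p.degree + 1), single n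
          (star (M b c) * ((√(n b) : ℝ) * star (opticalAmplitude M p (n - single b 1)))) := by
        rw [Finset.sum_comm]
        simp only [hcoeff, Finsupp.single_finsetSum]
    _ = ∑ b, star (M b c) • create b (opticalAdjoint M (single p 1)) := by
        refine Finset.sum_congr rfl fun b _ => ?_
        rw [sum_finsuppAntidiag_succ _ b _ fun n hn => by simp [hn], opticalAdjoint_single, map_sum,
          Finset.smul_sum]
        simp only [add_tsub_cancel_right, Finsupp.add_apply, Finsupp.single_eq_same, Nat.cast_add,
          Nat.cast_one, create_single, Finsupp.smul_single, smul_eq_mul, mul_comm]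
    _ = _ := by simp

end LinearOptics

section Jumps

open Finsupp (single)

variable {m : ℕ}

/-- The quantum jump `ρ ↦ a_c ρ a_c†` that removes one photon from mode `c`. -/
noncomputable def jump (c : Fin m) : Module.End ℂ (FockOp m) := sandwich (create c) (create c)

theorem jump_apply (c : Fin m) (ρ : FockOp m) (p q : Fin m →₀ ℕ) :
    jump c ρ p q = (√(p c + 1) : ℝ) * (√(q c + 1) : ℝ) * ρ (p + single c 1) (q + single c 1) := by
  simp [jump, sandwich_apply, create_single, matrixElement_single_single, mul_right_comm]

theorem jump_commute (b c : Fin m) : Commute (jump b) (jump c) := by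
  refine LinearMap.ext fun ρ => ?_
  simp only [jump, Module.End.mul_apply, sandwich_sandwich, create_comp_create_comm b c]

/-- The total jump operator in which mode `c` loses photons at the rate `w c`. -/
noncomputable def weightedJump (w : Fin m → ℝ) : Module.End ℂ (FockOp m) :=
  ∑ c, (w c : ℂ) • jump c

theorem weightedJump_apply (w : Fin m → ℝ) (ρ : FockOp m) :
    weightedJump w ρ = ∑ c, (w c : ℂ) • jump c ρ := by
  simp [weightedJump]

theorem weightedJump_add (w w' : Fin m → ℝ) :
    weightedJump (w + w') = weightedJump w + weightedJump w' := by
  simp only [weightedJump, Pi.add_apply, Complex.ofReal_add, add_smul, Finset.sum_add_distrib]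

theorem weightedJump_commute (w w' : Fin m → ℝ) :
    Commute (weightedJump w) (weightedJump w') :=
  .sum_left _ _ _ fun b _ => .sum_right _ _ _ fun c _ =>
    ((jump_commute b c).smul_left _).smul_right _

theorem posSemidef_weightedJump {w : Fin m → ℝ} (hw : 0 ≤ w) {ρ : FockOp m}
    (hρ : ρ.PosSemidef) : (weightedJump w ρ).PosSemidef := by
  rw [weightedJump_apply]
  exact Matrix.posSemidef_sum _ fun c _ =>
    (posSemidef_sandwich _ hρ).smul (Complex.zero_le_real.2 (hw c))

/-- The operator `|n⟩ ↦ (∏ c, η c ^ (n c / 2)) |n⟩`. -/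
noncomputable def attenuate (η : Fin m → ℝ) : FockVec m →ₗ[ℂ] FockVec m :=
  Finsupp.linearCombination ℂ fun n => single n ((∏ c, √(η c) ^ n c : ℝ) : ℂ)

theorem attenuate_single (η : Fin m → ℝ) (n : Fin m →₀ ℕ) (x : ℂ) :
    attenuate η (single n x) = single n (x * (∏ c, √(η c) ^ n c : ℝ)) := by
  simp [attenuate]

theorem attenuate_comp_attenuate {η : Fin m → ℝ} (hη : 0 ≤ η) (η' : Fin m → ℝ) :
    attenuate η' ∘ₗ attenuate η = attenuate (η * η') := by
  ext1 n
  refine LinearMap.ext_ring ?_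
  simp [attenuate_single, Real.sqrt_mul (hη _), mul_pow, Finset.prod_mul_distrib]

theorem attenuate_comp_create (η : Fin m → ℝ) (c : Fin m) :
    attenuate η ∘ₗ create c = ((√(η c) : ℝ) : ℂ) • create c ∘ₗ attenuate η := by
  ext1 n
  refine LinearMap.ext_ring ?_
  have hprod : ∏ a, √(η a) ^ (n + single c 1 : Fin m →₀ ℕ) a = √(η c) * ∏ a, √(η a) ^ n a := by
    simp only [Finsupp.add_apply, pow_add, Finset.prod_mul_distrib, Finsupp.single_apply, pow_ite,
      pow_one, pow_zero, Finset.prod_ite_eq, Finset.mem_univ, if_true, mul_comm]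
  simp only [LinearMap.comp_apply, LinearMap.smul_apply, Finsupp.lsingle_apply, create_single,
    attenuate_single, hprod, Finsupp.smul_single, smul_eq_mul, Complex.ofReal_mul]
  ring_nf

/-- The evolution between the jumps: the Kraus map of the event that all photons survive a loss
element of transmissivity `η c` in each mode `c`. -/
noncomputable def survival (η : Fin m → ℝ) : Module.End ℂ (FockOp m) :=
  sandwich (attenuate η) (attenuate η)

theorem survival_apply (η : Fin m → ℝ) (ρ : FockOp m) (p q : Fin m →₀ ℕ) :
    survival η ρ p q = (∏ c, √(η c) ^ p c : ℝ) * ρ p q * (∏ c, √(η c) ^ q c : ℝ) := by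
  rw [survival, sandwich_apply, attenuate_single, attenuate_single, matrixElement_single_single,
    one_mul, one_mul, Complex.star_def, Complex.conj_ofReal]

theorem survival_mul_survival {η : Fin m → ℝ} (hη : 0 ≤ η) (η' : Fin m → ℝ) :
    survival η * survival η' = survival (η * η') := by
  refine LinearMap.ext fun ρ => ?_
  simp only [survival, Module.End.mul_apply, sandwich_sandwich,
    attenuate_comp_attenuate hη]

theorem jump_mul_survival {η : Fin m → ℝ} (hη : 0 ≤ η) (c : Fin m) :
    jump c * survival η = survival η * (η c : ℂ) • jump c := by
  have hsq : ((√(η c) : ℝ) : ℂ) * (√(η c) : ℝ) = η c := by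
    rw [← Complex.ofReal_mul, Real.mul_self_sqrt (hη c)]
  refine LinearMap.ext fun ρ => ?_
  simp only [jump, survival, Module.End.mul_apply, LinearMap.smul_apply, map_smul,
    sandwich_sandwich, attenuate_comp_create]
  ext p q
  simp only [Matrix.smul_apply, sandwich_apply, LinearMap.smul_apply, map_smul, map_smulₛₗ,
    smul_eq_mul, Complex.conj_ofReal, ← hsq, mul_assoc]

theorem weightedJump_mul_survival {η : Fin m → ℝ} (hη : 0 ≤ η) (w : Fin m → ℝ) :
    weightedJump w * survival η = survival η * weightedJump (w * η) := by
  simp only [weightedJump, Finset.sum_mul, Finset.mul_sum, smul_mul_assoc, jump_mul_survival hη,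
    mul_smul_comm, smul_smul, Pi.mul_apply, Complex.ofReal_mul]

theorem weightedJump_pow_mul_survival {η : Fin m → ℝ} (hη : 0 ≤ η) (w : Fin m → ℝ) (k : ℕ) :
    weightedJump w ^ k * survival η = survival η * weightedJump (w * η) ^ k :=
  (SemiconjBy.pow_right (x := weightedJump (w * η)) (y := weightedJump w)
    (weightedJump_mul_survival hη w).symm k).symm

end Jumps

section OpticalChannel

open Finsupp (single)

variable {m : ℕ}

/-- The channel `ρ ↦ φ(M) ρ φ(M)†`. -/
noncomputable def opticalChannel (M : Matrix (Fin m) (Fin m) ℂ) : Module.End ℂ (FockOp m) :=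
  sandwich (opticalAdjoint M) (opticalAdjoint M)

theorem opticalChannel_apply (M : Matrix (Fin m) (Fin m) ℂ) (ρ : FockOp m) (p q : Fin m →₀ ℕ) :
    opticalChannel M ρ p q =
      ∑ n ∈ Finset.finsuppAntidiag Finset.univ p.degree,
        ∑ n' ∈ Finset.finsuppAntidiag Finset.univ q.degree,
          opticalAmplitude M p n * ρ n n' * star (opticalAmplitude M q n') := by
  simp only [opticalChannel, sandwich_apply, opticalAdjoint_single, map_sum, LinearMap.sum_apply,
    matrixElement_single_single, star_star]
  rw [Finset.sum_comm]

theorem weightedJump_commute_opticalChannel {M : Matrix (Fin m) (Fin m) ℂ}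
    (hM : M * M.conjTranspose = 1) {w : Fin m → ℝ} (hw : ∀ b c, M b c ≠ 0 → w b = w c) :
    Commute (weightedJump w) (opticalChannel M) := by
  have horth (b b' : Fin m) : ∑ c, (w c : ℂ) * (M b c * star (M b' c)) =
      if b = b' then (w b : ℂ) else 0 := by
    calc ∑ c, (w c : ℂ) * (M b c * star (M b' c)) = w b * (M * M.conjTranspose) b b' := by
          rw [Matrix.mul_apply, Finset.mul_sum]
          refine Finset.sum_congr rfl fun c _ => ?_
          by_cases hbc : M b c = 0
          · simp [hbc]
          · rw [hw b c hbc, Matrix.conjTranspose_apply]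
      _ = _ := by rw [hM, Matrix.one_apply, mul_ite, mul_one, mul_zero]
  refine LinearMap.ext fun ρ => ?_
  ext p q
  let E (b b' : Fin m) : ℂ := matrixElement ρ (create b (opticalAdjoint M (single p 1)))
    (create b' (opticalAdjoint M (single q 1)))
  have hjump (c : Fin m) : jump c (opticalChannel M ρ) p q =
      ∑ b, ∑ b', M b c * star (M b' c) * E b b' := by
    rw [jump, opticalChannel, sandwich_sandwich, opticalAdjoint_comp_create, sandwich_apply]
    simp only [LinearMap.sum_apply, LinearMap.smul_apply, map_sum, map_smul, map_smulₛₗ,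
      smul_eq_mul, LinearMap.comp_apply, starRingEnd_apply, star_star, Finset.mul_sum, E]
    rw [Finset.sum_comm]
    exact Finset.sum_congr rfl fun b _ => Finset.sum_congr rfl fun b' _ => by ring
  calc weightedJump w (opticalChannel M ρ) p q
      = ∑ c, w c * ∑ b, ∑ b', M b c * star (M b' c) * E b b' := by
        simp only [weightedJump_apply, Matrix.sum_apply, Matrix.smul_apply, hjump, smul_eq_mul]
    _ = ∑ b, ∑ b', (∑ c, w c * (M b c * star (M b' c))) * E b b' := by
        simp only [Finset.mul_sum, Finset.sum_mul, mul_assoc]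
        rw [Finset.sum_comm]
        exact Finset.sum_congr rfl fun b _ => Finset.sum_comm
    _ = ∑ b, w b * E b b := by simp only [horth, ite_mul, zero_mul, Finset.sum_ite_eq,
          Finset.mem_univ, if_true]
    _ = opticalChannel M (weightedJump w ρ) p q := by
        simp only [weightedJump_apply, map_sum, map_smul, opticalChannel, jump, sandwich_sandwich]
        simp only [Matrix.sum_apply, Matrix.smul_apply, smul_eq_mul, sandwich_apply,
          LinearMap.comp_apply, E]

theorem coeff_aeval_C_mul_X {σ R : Type*} [Fintype σ] [CommSemiring R] (t : σ → R)
    (f : MvPolynomial σ R) (p : σ →₀ ℕ) :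
    MvPolynomial.coeff p (MvPolynomial.aeval (fun c => MvPolynomial.C (t c) * MvPolynomial.X c) f) =
      (∏ c, t c ^ p c) * MvPolynomial.coeff p f := by
  classical
  induction f using MvPolynomial.induction_on' with
  | monomial n a =>
    have hmonomial : MvPolynomial.aeval (fun c => MvPolynomial.C (t c) * MvPolynomial.X c)
        (MvPolynomial.monomial n a) =
          MvPolynomial.C (∏ c, t c ^ n c) * MvPolynomial.monomial n a := by
      rw [MvPolynomial.aeval_monomial, Finsupp.prod_fintype _ _ fun _ => pow_zero _,
        MvPolynomial.monomial_eq, Finsupp.prod_fintype _ _ fun _ => pow_zero _]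
      simp only [mul_pow, Finset.prod_mul_distrib, map_prod, map_pow, MvPolynomial.algebraMap_eq]
      ring
    rw [hmonomial, MvPolynomial.coeff_C_mul, MvPolynomial.coeff_monomial]
    split_ifs with h
    · rw [h]
    · rw [mul_zero, mul_zero]
  | add f g hf hg => rw [map_add, MvPolynomial.coeff_add, hf, hg, MvPolynomial.coeff_add, mul_add]

theorem opticalAmplitude_mul_prod_pow (M : Matrix (Fin m) (Fin m) ℂ) {t : Fin m → ℂ}
    (ht : ∀ a c, M a c ≠ 0 → t a = t c) (p n : Fin m →₀ ℕ) :
    opticalAmplitude M p n * ∏ c, t c ^ n c = (∏ c, t c ^ p c) * opticalAmplitude M p n := by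
  let row (a : Fin m) : MvPolynomial (Fin m) ℂ := ∑ c, MvPolynomial.C (M a c) * MvPolynomial.X c
  let scale := MvPolynomial.aeval (R := ℂ) fun c => MvPolynomial.C (t c) * MvPolynomial.X c
  have hrow (a : Fin m) : scale (row a) = MvPolynomial.C (t a) * row a := by
    simp only [scale, row, map_sum, map_mul, MvPolynomial.aeval_X, MvPolynomial.algHom_C,
      MvPolynomial.algebraMap_eq, Finset.mul_sum]
    refine Finset.sum_congr rfl fun c _ => ?_
    by_cases h : M a c = 0
    · simp [h]
    · rw [ht a c h]
      ring
  have hsubst : modeSubst M (MvPolynomial.monomial n 1) = ∏ a, row a ^ n a := by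
    rw [modeSubst, MvPolynomial.aeval_monomial, map_one, one_mul,
      Finsupp.prod_fintype _ _ fun _ => pow_zero _]
  have hscale : scale (∏ a, row a ^ n a) =
      MvPolynomial.C (∏ c, t c ^ n c) * ∏ a, row a ^ n a := by
    simp only [map_prod, map_pow, hrow, mul_pow, Finset.prod_mul_distrib]
  have hcoeff := congrArg (MvPolynomial.coeff p) hscale
  rw [coeff_aeval_C_mul_X, MvPolynomial.coeff_C_mul] at hcoeff
  rw [opticalAmplitude, hsubst, mul_assoc, mul_comm (MvPolynomial.coeff _ _), ← hcoeff]
  ring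

theorem survival_commute_opticalChannel (M : Matrix (Fin m) (Fin m) ℂ) {η : Fin m → ℝ}
    (hη : ∀ a c, M a c ≠ 0 → η a = η c) : Commute (survival η) (opticalChannel M) := by
  have hamp (p n : Fin m →₀ ℕ) := opticalAmplitude_mul_prod_pow M (t := fun c => (√(η c) : ℝ))
    (fun a c h => by rw [hη a c h]) p n
  have hadj : opticalAdjoint M ∘ₗ attenuate η = attenuate η ∘ₗ opticalAdjoint M := by
    ext1 p
    refine LinearMap.ext_ring ?_
    simp only [LinearMap.comp_apply, Finsupp.lsingle_apply]
    rw [attenuate_single, mul_comm, ← smul_eq_mul, ← Finsupp.smul_single, map_smul,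
      opticalAdjoint_single, map_sum, Finset.smul_sum]
    refine Finset.sum_congr rfl fun n _ => ?_
    have := congrArg star (hamp p n)
    simp only [star_mul', ← Complex.ofReal_pow, ← Complex.ofReal_prod, Complex.star_def,
      Complex.conj_ofReal] at this
    rw [attenuate_single, Finsupp.smul_single, smul_eq_mul, Complex.star_def, this]
  refine LinearMap.ext fun ρ => ?_
  simp only [survival, opticalChannel, Module.End.mul_apply, sandwich_sandwich, hadj]

end OpticalChannel

section TwoModes

variable {m : ℕ}

/-- The linear-optical transformation of all the modes that acts by `V` on the modes `i`, `j` and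
trivially on the others. -/
noncomputable def modeMatrix (V : Matrix (Fin 2) (Fin 2) ℂ) (i j : Fin m) :
    Matrix (Fin m) (Fin m) ℂ :=
  let E : Matrix (Fin m) (Fin 2) ℂ := (1 : Matrix (Fin m) (Fin m) ℂ).submatrix id ![i, j]
  1 + E * (V - 1) * E.conjTranspose

theorem modeMatrix_mul_conjTranspose {V : Matrix (Fin 2) (Fin 2) ℂ} (hV : V * V.conjTranspose = 1)
    {i j : Fin m} (hij : i ≠ j) : modeMatrix V i j * (modeMatrix V i j).conjTranspose = 1 := by
  set E : Matrix (Fin m) (Fin 2) ℂ := (1 : Matrix (Fin m) (Fin m) ℂ).submatrix id ![i, j] with hE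
  have hEE : E.conjTranspose * E = 1 := by
    have hinj : Function.Injective ![i, j] := by
      simpa [Function.Injective, Fin.forall_fin_two] using ⟨hij, hij.symm⟩
    rw [hE, Matrix.conjTranspose_submatrix, Matrix.conjTranspose_one,
      ← Matrix.submatrix_mul _ _ _ _ _ Function.bijective_id, Matrix.one_mul,
      Matrix.submatrix_one _ hinj]
  have hX : (V - 1) + (V - 1).conjTranspose + (V - 1) * (V - 1).conjTranspose = 0 := by
    rw [Matrix.conjTranspose_sub, Matrix.conjTranspose_one, sub_mul, mul_sub, hV]
    noncomm_ring
  calc modeMatrix V i j * (modeMatrix V i j).conjTranspose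
      = 1 + E * ((V - 1) + (V - 1).conjTranspose +
          (V - 1) * (E.conjTranspose * E) * (V - 1).conjTranspose) * E.conjTranspose := by
        simp only [modeMatrix, ← hE, Matrix.conjTranspose_add, Matrix.conjTranspose_one,
          Matrix.conjTranspose_mul, Matrix.conjTranspose_conjTranspose, add_mul, mul_add,
          Matrix.mul_add, Matrix.add_mul, Matrix.mul_assoc, one_mul, mul_one]
        abel
    _ = 1 := by rw [hEE, mul_one, hX, Matrix.mul_zero, Matrix.zero_mul, add_zero]

theorem modeMatrix_apply (V : Matrix (Fin 2) (Fin 2) ℂ) {i j : Fin m} (hij : i ≠ j)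
    (a c : Fin m) : modeMatrix V i j a c =
      if a = i then (if c = i then V 0 0 else if c = j then V 0 1 else 0)
      else if a = j then (if c = i then V 1 0 else if c = j then V 1 1 else 0)
      else if a = c then 1 else 0 := by
  simp only [modeMatrix, Matrix.add_apply, Matrix.mul_apply, Fin.sum_univ_two, Matrix.sub_apply,
    Matrix.conjTranspose_apply, Matrix.submatrix_apply, Matrix.one_apply, id, Matrix.cons_val_zero,
    Matrix.cons_val_one]
  rcases eq_or_ne a i with rfl | hai
  · rcases eq_or_ne c a with rfl | hca
    · simp [hij]
    · rcases eq_or_ne c j with rfl | hcj <;> simp [*, hca.symm]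
  · rcases eq_or_ne a j with rfl | haj
    · rcases eq_or_ne c i with rfl | hci
      · simp [hai, hai.symm]
      · rcases eq_or_ne c a with rfl | hca
        · simp [hai]
        · simp [*, hca.symm]
    · simp [hai, haj]

theorem eq_of_modeMatrix_ne_zero {α : Type*} {V : Matrix (Fin 2) (Fin 2) ℂ} {i j : Fin m}
    (hij : i ≠ j) {f : Fin m → α} (hf : f i = f j) {a c : Fin m} (h : modeMatrix V i j a c ≠ 0) :
    f a = f c := by
  rw [modeMatrix_apply V hij] at h
  split_ifs at h <;> simp_all

theorem creationImage_eq (V : Matrix (Fin 2) (Fin 2) ℂ) {i j : Fin m} (hij : i ≠ j) (a : Fin m) :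
    creationImage V i j a = ∑ c, MvPolynomial.C (modeMatrix V i j a c) * MvPolynomial.X c := by
  have hsum (x y : ℂ) : ∑ c, MvPolynomial.C (if c = i then x else if c = j then y else 0) *
      MvPolynomial.X c =
        MvPolynomial.C x * MvPolynomial.X i + MvPolynomial.C y * MvPolynomial.X j := by
    rw [← Finset.add_sum_erase _ _ (Finset.mem_univ i),
      Finset.sum_eq_single_of_mem j (by simp [hij.symm]) fun c hc hcj => by
        simp [Finset.ne_of_mem_erase hc, hcj]]
    simp [hij.symm]
  simp only [modeMatrix_apply V hij, creationImage]
  split_ifs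
  · exact (hsum _ _).symm
  · exact (hsum _ _).symm
  · simp [apply_ite]

theorem gateAmplitude_eq (V : Matrix (Fin 2) (Fin 2) ℂ) {i j : Fin m} (hij : i ≠ j)
    (p n : Fin m →₀ ℕ) : gateAmplitude V i j p n = opticalAmplitude (modeMatrix V i j) p n := by
  rw [gateAmplitude, opticalAmplitude, modeSubst, MvPolynomial.aeval_monomial, map_one, one_mul,
    Finsupp.prod_fintype _ _ fun _ => pow_zero _]
  simp only [creationImage_eq V hij]

theorem gateChannel_eq (V : Matrix (Fin 2) (Fin 2) ℂ) {i j : Fin m} (hij : i ≠ j) (ρ : FockOp m) :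
    gateChannel V i j ρ = opticalChannel (modeMatrix V i j) ρ := by
  ext p q
  simp only [gateChannel, gateAmplitude_eq V hij, opticalChannel_apply]

end TwoModes

section TraceClass

theorem posSemidef_diag_eq_re {ι : Type*} {A : Matrix ι ι ℂ} (hA : A.PosSemidef) (n : ι) :
    A n n = ((A n n).re : ℂ) :=
  Complex.ext rfl (Complex.nonneg_iff.1 hA.diag_nonneg).2.symm

theorem re_diag_nonneg {ι : Type*} {A : Matrix ι ι ℂ} (hA : A.PosSemidef) (n : ι) :
    0 ≤ (A n n).re :=
  (Complex.nonneg_iff.1 hA.diag_nonneg).1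

theorem norm_apply_le_re_diag_add {ι : Type*} {A : Matrix ι ι ℂ} (hA : A.PosSemidef) (p q : ι) :
    ‖A p q‖ ≤ (A p p).re + (A q q).re := by
  have hdet := (hA.submatrix ![p, q]).det_nonneg
  have hqp : A q p = star (A p q) := (hA.1.apply q p).symm
  rw [Matrix.det_fin_two] at hdet
  simp only [Matrix.submatrix_apply, Matrix.cons_val_zero, Matrix.cons_val_one] at hdet
  rw [hqp, posSemidef_diag_eq_re hA p, posSemidef_diag_eq_re hA q, Complex.star_def,
    Complex.mul_conj, Complex.normSq_eq_norm_sq, ← Complex.ofReal_mul, ← Complex.ofReal_sub,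
    Complex.zero_le_real] at hdet
  nlinarith [norm_nonneg (A p q), re_diag_nonneg hA p, re_diag_nonneg hA q]

theorem summable_of_summable_re_diag {ι κ : Type*} {A : κ → Matrix ι ι ℂ}
    (hA : ∀ k, (A k).PosSemidef) (hdiag : ∀ n, Summable fun k => (A k n n).re) : Summable A :=
  Pi.summable.2 fun p => Pi.summable.2 fun q =>
    .of_norm_bounded ((hdiag p).add (hdiag q)) fun k => norm_apply_le_re_diag_add (hA k) p q

theorem posSemidef_of_hasSum {ι κ : Type*} {A : κ → Matrix ι ι ℂ} {B : Matrix ι ι ℂ}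
    (hA : ∀ k, (A k).PosSemidef) (hB : HasSum A B) : B.PosSemidef := by
  have happly (p q : ι) : HasSum (fun k => A k p q) (B p q) :=
    Pi.hasSum.1 (Pi.hasSum.1 hB p) q
  refine ⟨?_, fun x => ?_⟩
  · ext p q
    have hstar := (happly q p).star
    simp only [(hA _).1.apply p q] at hstar
    exact hstar.unique (happly p q)
  · exact (hasSum_sum fun p _ => hasSum_sum fun q _ =>
      ((happly p q).mul_left _).mul_right _).nonneg fun k => (hA k).2 x

theorem summable_iff_summable_sum_fiber {α β : Type*} {f : α → ℝ} (hf : 0 ≤ f) (g : α → β)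
    (s : β → Finset α) (hs : ∀ x b, x ∈ s b ↔ g x = b) :
    Summable f ↔ Summable fun b => ∑ x ∈ s b, f x := by
  have hfiber (b : β) : HasSum (fun x : {x // g x = b} => f x) (∑ x ∈ s b, f x) :=
    (Equiv.subtypeEquivRight fun x => hs x b).hasSum_iff.1 ((s b).hasSum f)
  rw [← (Equiv.sigmaFiberEquiv g).summable_iff, summable_sigma_of_nonneg fun x => by exact hf _]
  exact ⟨fun h => h.2.congr fun b => (hfiber b).tsum_eq,
    fun h => ⟨fun b => (hfiber b).summable, h.congr fun b => (hfiber b).tsum_eq.symm⟩⟩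

variable {m : ℕ}

/-- Positive operators with finite trace. -/
def IsTraceClass (ρ : FockOp m) : Prop := ρ.PosSemidef ∧ Summable fun n => (ρ n n).re

theorem IsState.isTraceClass {ρ : FockOp m} (hρ : IsState ρ) : IsTraceClass ρ :=
  ⟨hρ.1, Complex.reCLM.summable hρ.2.summable⟩

end TraceClass

section Series

open Finset (finsuppAntidiag)
open Finset.HasAntidiagonal (antidiagonal)
open scoped Nat

variable {m : ℕ}

/-- The instrument of loss elements of transmissivity `η c` in each mode `c`: the `d`-th coefficient
is the operation in which exactly `d` photons are lost. As a series in a formal variable `X` it is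
`K_η exp (J X)`, where `K_η` is the evolution without losses and `J` the total jump operator with
rates `1 - η`. -/
noncomputable def lossSeries (η : Fin m → ℝ) : PowerSeries (Module.End ℂ (FockOp m)) :=
  PowerSeries.mk fun d => (d ! : ℂ)⁻¹ • (survival η * weightedJump (1 - η) ^ d)

theorem coeff_lossSeries (η : Fin m → ℝ) (d : ℕ) :
    (lossSeries η).coeff d = (d ! : ℂ)⁻¹ • (survival η * weightedJump (1 - η) ^ d) :=
  PowerSeries.coeff_mk _ _

theorem lossSeries_mul {η η' : Fin m → ℝ} (hη : 0 ≤ η) (hη' : 0 ≤ η') :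
    lossSeries η * lossSeries η' = lossSeries (η * η') := by
  ext1 d
  have hrate : 1 - η * η' = (1 - η) * η' + (1 - η') := by ring
  have hterm (x : ℕ × ℕ) (hx : x ∈ antidiagonal d) :
      (lossSeries η).coeff x.1 * (lossSeries η').coeff x.2 = (d ! : ℂ)⁻¹ • (survival (η * η') *
        d.choose x.1 • (weightedJump ((1 - η) * η') ^ x.1 * weightedJump (1 - η') ^ x.2)) := by
    have hfact : (x.1 ! : ℂ)⁻¹ * (x.2 ! : ℂ)⁻¹ = (d ! : ℂ)⁻¹ * d.choose x.1 := by
      rw [Finset.HasAntidiagonal.mem_antidiagonal] at hx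
      rw [← hx, Nat.cast_add_choose]
      field_simp
    have hmove := weightedJump_pow_mul_survival hη' (1 - η) x.1
    calc (lossSeries η).coeff x.1 * (lossSeries η').coeff x.2
        = ((x.1 ! : ℂ)⁻¹ * (x.2 ! : ℂ)⁻¹) • (survival η * (weightedJump (1 - η) ^ x.1 *
            survival η') * weightedJump (1 - η') ^ x.2) := by
          rw [coeff_lossSeries, coeff_lossSeries, smul_mul_smul_comm]
          simp only [mul_assoc]
      _ = _ := by
          rw [hmove, hfact, mul_smul, Nat.cast_smul_eq_nsmul, ← mul_assoc,
            survival_mul_survival hη, mul_assoc, mul_smul_comm]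
  rw [PowerSeries.coeff_mul, Finset.sum_congr rfl hterm, ← Finset.smul_sum, ← Finset.mul_sum,
    ← (weightedJump_commute _ _).add_pow', ← weightedJump_add, ← hrate, coeff_lossSeries]

theorem lossSeries_one : lossSeries (1 : Fin m → ℝ) = 1 := by
  refine PowerSeries.ext fun d => LinearMap.ext fun ρ => Matrix.ext fun p q => ?_
  rcases eq_or_ne d 0 with rfl | hd
  · simp [coeff_lossSeries, survival_apply]
  · simp [coeff_lossSeries, PowerSeries.coeff_one, weightedJump, hd]

theorem commute_lossSeries_C {η : Fin m → ℝ} {T : Module.End ℂ (FockOp m)}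
    (hsurvival : Commute (survival η) T) (hjump : Commute (weightedJump (1 - η)) T) :
    Commute (lossSeries η) (PowerSeries.C T) := by
  refine PowerSeries.ext fun d => ?_
  rw [PowerSeries.coeff_mul_C, PowerSeries.coeff_C_mul, coeff_lossSeries]
  exact (hsurvival.mul_left (hjump.pow_left d)).smul_left _

theorem sum_diag_weightedJump_one (N : ℕ) (ρ : FockOp m) :
    ∑ n ∈ finsuppAntidiag Finset.univ N, weightedJump 1 ρ n n =
      (N + 1) * ∑ n ∈ finsuppAntidiag Finset.univ (N + 1), ρ n n := by
  have hjump (c : Fin m) : ∑ n ∈ finsuppAntidiag Finset.univ N, jump c ρ n n =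
      ∑ n ∈ finsuppAntidiag Finset.univ (N + 1), (n c : ℂ) * ρ n n := by
    rw [sum_finsuppAntidiag_succ N c _ fun n hn => by simp [hn]]
    refine Finset.sum_congr rfl fun n _ => ?_
    rw [jump_apply, ← Complex.ofReal_mul, Real.mul_self_sqrt (by positivity)]
    simp
  simp only [weightedJump_apply, Pi.one_apply, Complex.ofReal_one, one_smul, Matrix.sum_apply]
  rw [Finset.sum_comm, Finset.sum_congr rfl fun c _ => hjump c, Finset.sum_comm, Finset.mul_sum]
  refine Finset.sum_congr rfl fun n hn => ?_
  rw [← Finset.sum_mul, ← Nat.cast_sum, ← Finsupp.degree_eq_sum,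
    (mem_finsuppAntidiag_univ _ _).1 hn]
  simp

theorem weightedJump_one_pow_apply_zero (d : ℕ) (ρ : FockOp m) :
    (weightedJump 1 ^ d) ρ 0 0 = d ! * ∑ n ∈ finsuppAntidiag Finset.univ d, ρ n n := by
  induction d generalizing ρ with
  | zero => simp
  | succ d ih =>
    rw [pow_succ, Module.End.mul_apply, ih, sum_diag_weightedJump_one, Nat.factorial_succ]
    push_cast
    ring

theorem coeff_lossSeries_zero_apply_zero (d : ℕ) (ρ : FockOp m) :
    (lossSeries 0).coeff d ρ 0 0 = ∑ n ∈ finsuppAntidiag Finset.univ d, ρ n n := by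
  rw [coeff_lossSeries, LinearMap.smul_apply, Matrix.smul_apply, Module.End.mul_apply,
    survival_apply, sub_zero, weightedJump_one_pow_apply_zero]
  have : (d ! : ℂ) ≠ 0 := mod_cast d.factorial_ne_zero
  simp [this]

/-- The coefficients of the series form a quantum instrument whose outcome is the number of lost
photons: they are positive maps, and together they preserve the trace. Absorbing all the photons
that are left, by `lossSeries 0`, turns the trace of the part with `d` photons into a matrix element
of the vacuum. -/
structure IsInstrument (S : PowerSeries (Module.End ℂ (FockOp m))) : Prop where
  continuous : ∀ d, Continuous (S.coeff d)
  posSemidef : ∀ d ρ, ρ.PosSemidef → (S.coeff d ρ).PosSemidef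
  trace : ∀ d ρ, (lossSeries 0 * S).coeff d ρ 0 0 = (lossSeries 0).coeff d ρ 0 0

theorem continuous_weightedJump (w : Fin m → ℝ) : Continuous (weightedJump w) := by
  rw [show ⇑(weightedJump w) = fun ρ => ∑ c, (w c : ℂ) • jump c ρ from
    funext (weightedJump_apply w)]
  exact continuous_finsetSum _ fun c _ =>
    (continuous_sandwich (create c) (create c)).const_smul (w c : ℂ)

theorem isInstrument_lossSeries {η : Fin m → ℝ} (h0 : 0 ≤ η) (h1 : η ≤ 1) :
    IsInstrument (lossSeries η) where
  continuous d := by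
    have hpow : Continuous (weightedJump (1 - η) ^ d) := by
      rw [Module.End.coe_pow]
      exact (continuous_weightedJump _).iterate d
    rw [coeff_lossSeries]
    exact ((continuous_sandwich (attenuate η) (attenuate η)).comp hpow).const_smul (d ! : ℂ)⁻¹
  posSemidef d ρ hρ := by
    have hpow (k : ℕ) : ((weightedJump (1 - η) ^ k) ρ).PosSemidef := by
      induction k with
      | zero => simpa using hρ
      | succ k ih =>
        rw [pow_succ', Module.End.mul_apply]
        exact posSemidef_weightedJump (sub_nonneg.2 h1) ih
    rw [coeff_lossSeries]
    exact (posSemidef_sandwich (attenuate η) (hpow d)).smul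
      (show (0 : ℂ) ≤ (d ! : ℂ)⁻¹ by positivity)
  trace d ρ := by rw [lossSeries_mul le_rfl h0, zero_mul]

theorem isInstrument_opticalChannel {M : Matrix (Fin m) (Fin m) ℂ} (hM : M * M.conjTranspose = 1) :
    IsInstrument (PowerSeries.C (opticalChannel M)) where
  continuous d := by
    rw [PowerSeries.coeff_C]
    split_ifs
    · exact continuous_sandwich _ _
    · exact continuous_const
  posSemidef d ρ hρ := by
    rw [PowerSeries.coeff_C]
    split_ifs
    · exact posSemidef_sandwich _ hρ
    · exact .zero
  trace d ρ := by
    have hcomm : Commute (lossSeries 0) (PowerSeries.C (opticalChannel M)) :=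
      commute_lossSeries_C (survival_commute_opticalChannel M fun _ _ _ => rfl)
        (weightedJump_commute_opticalChannel hM fun _ _ _ => rfl)
    rw [hcomm.eq, PowerSeries.coeff_C_mul, Module.End.mul_apply, opticalChannel_apply]
    simp [opticalAmplitude, occFactorial]

theorem IsInstrument.one : IsInstrument (1 : PowerSeries (Module.End ℂ (FockOp m))) where
  continuous d := by
    rw [PowerSeries.coeff_one]
    split_ifs
    · exact continuous_id
    · exact continuous_const
  posSemidef d ρ hρ := by
    rw [PowerSeries.coeff_one]
    split_ifs
    · exact hρ
    · exact .zero
  trace d ρ := by rw [mul_one]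

theorem IsInstrument.mul {S S' : PowerSeries (Module.End ℂ (FockOp m))} (hS : IsInstrument S)
    (hS' : IsInstrument S') : IsInstrument (S * S') where
  continuous d := by
    rw [show ⇑((S * S').coeff d) = fun ρ => ∑ x ∈ antidiagonal d, S.coeff x.1 (S'.coeff x.2 ρ) from
      funext fun ρ => by rw [PowerSeries.coeff_mul, LinearMap.sum_apply]; rfl]
    exact continuous_finsetSum _ fun x _ => (hS.continuous x.1).comp (hS'.continuous x.2)
  posSemidef d ρ hρ := by
    rw [PowerSeries.coeff_mul, LinearMap.sum_apply]
    exact Matrix.posSemidef_sum _ fun x _ => hS.posSemidef _ _ (hS'.posSemidef _ _ hρ)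
  trace d ρ := by
    rw [← mul_assoc, PowerSeries.coeff_mul, ← hS'.trace, PowerSeries.coeff_mul]
    simp only [LinearMap.sum_apply, Matrix.sum_apply, Module.End.mul_apply, hS.trace]

/-- The sum of the operations of an instrument. -/
noncomputable def channel (S : PowerSeries (Module.End ℂ (FockOp m))) (ρ : FockOp m) : FockOp m :=
  fun p q => ∑' d, S.coeff d ρ p q

namespace IsInstrument

variable {S S' : PowerSeries (Module.End ℂ (FockOp m))} {ρ : FockOp m}

theorem summable_re_diag (hS : IsInstrument S) (hρ : IsTraceClass ρ) :
    Summable fun x : ℕ × (Fin m →₀ ℕ) => (S.coeff x.1 ρ x.2 x.2).re := by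
  let s (d : ℕ) : Finset (ℕ × (Fin m →₀ ℕ)) :=
    (antidiagonal d).biUnion fun x => {x.2} ×ˢ finsuppAntidiag Finset.univ x.1
  have hs (x : ℕ × (Fin m →₀ ℕ)) (d : ℕ) : x ∈ s d ↔ x.2.degree + x.1 = d := by
    simp only [s, Finset.mem_biUnion, Finset.mem_product, Finset.mem_singleton,
      mem_finsuppAntidiag_univ, Finset.HasAntidiagonal.mem_antidiagonal]
    exact ⟨by rintro ⟨y, rfl, hsum, hdeg⟩; rw [hsum, hdeg], fun h => ⟨(_, _), h, rfl, rfl⟩⟩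
  have htrace (d : ℕ) : ∑ x ∈ s d, (S.coeff x.1 ρ x.2 x.2).re =
      ∑ n ∈ finsuppAntidiag Finset.univ d, (ρ n n).re := by
    have hdisj : (antidiagonal d : Set (ℕ × ℕ)).PairwiseDisjoint fun x =>
        ({x.2} : Finset ℕ) ×ˢ finsuppAntidiag (Finset.univ : Finset (Fin m)) x.1 := by
      refine fun x _ y _ hxy => Finset.disjoint_left.2 fun z hzx hzy => hxy ?_
      simp only [Finset.mem_product, Finset.mem_singleton, mem_finsuppAntidiag_univ] at hzx hzy
      exact Prod.ext (hzx.2.symm.trans hzy.2) (hzx.1.symm.trans hzy.1)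
    have := congrArg Complex.re (hS.trace d ρ)
    simp only [PowerSeries.coeff_mul, LinearMap.sum_apply, Matrix.sum_apply, Module.End.mul_apply,
      coeff_lossSeries_zero_apply_zero, Complex.re_sum] at this
    rw [← this, Finset.sum_biUnion hdisj]
    simp only [Finset.sum_product, Finset.sum_singleton]
  rw [summable_iff_summable_sum_fiber (fun x => re_diag_nonneg (hS.posSemidef _ _ hρ.1) x.2)
    (fun x => x.2.degree + x.1) s hs]
  simp only [htrace]
  exact (summable_iff_summable_sum_fiber (fun n => re_diag_nonneg hρ.1 n) Finsupp.degree _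
    mem_finsuppAntidiag_univ).1 hρ.2

theorem hasSum_channel (hS : IsInstrument S) (hρ : IsTraceClass ρ) :
    HasSum (fun d => S.coeff d ρ) (channel S ρ) := by
  have hsum : Summable fun d => S.coeff d ρ :=
    summable_of_summable_re_diag (fun d => hS.posSemidef d ρ hρ.1) fun n =>
      (hS.summable_re_diag hρ).prod_symm.prod_factor n
  have hlimit : ∑' d, S.coeff d ρ = channel S ρ := by
    ext p q
    exact (Pi.hasSum.1 (Pi.hasSum.1 hsum.hasSum p) q).tsum_eq.symm
  exact hlimit ▸ hsum.hasSum

theorem isTraceClass_channel (hS : IsInstrument S) (hρ : IsTraceClass ρ) :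
    IsTraceClass (channel S ρ) := by
  refine ⟨posSemidef_of_hasSum (fun d => hS.posSemidef d ρ hρ.1) (hS.hasSum_channel hρ), ?_⟩
  refine (hS.summable_re_diag hρ).prod_symm.prod.congr fun n => ?_
  exact (Complex.hasSum_re (Pi.hasSum.1 (Pi.hasSum.1 (hS.hasSum_channel hρ) n) n)).tsum_eq

theorem channel_mul (hS : IsInstrument S) (hS' : IsInstrument S') (hρ : IsTraceClass ρ) :
    channel (S * S') ρ = channel S (channel S' ρ) := by
  let A (x : ℕ × ℕ) : FockOp m := S.coeff x.1 (S'.coeff x.2 ρ)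
  have hcoeff (d : ℕ) : ∑ x ∈ antidiagonal d, A x = (S * S').coeff d ρ := by
    rw [PowerSeries.coeff_mul, LinearMap.sum_apply]
    rfl
  have hA (x : ℕ × ℕ) : (A x).PosSemidef := hS.posSemidef _ _ (hS'.posSemidef _ _ hρ.1)
  have hsum : Summable A := by
    refine summable_of_summable_re_diag hA fun n => ?_
    have hdiag := ((hS.mul hS').summable_re_diag hρ).prod_symm.prod_factor n
    rw [summable_iff_summable_sum_fiber (fun x => re_diag_nonneg (hA x) n) (fun x => x.1 + x.2)
      antidiagonal fun x d => Finset.HasAntidiagonal.mem_antidiagonal]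
    simpa only [← hcoeff, Matrix.sum_apply, Complex.re_sum, Prod.swap_prod_mk] using hdiag
  have hdiagonals : HasSum (fun d => (S * S').coeff d ρ) (∑' x, A x) := by
    simp only [← hcoeff]
    exact (Finset.HasAntidiagonal.sigmaAntidiagonalEquivProd.hasSum_iff.2 hsum.hasSum).sigma
      fun d => (antidiagonal d).hasSum A
  have hrows : HasSum (fun k => S.coeff k (channel S' ρ)) (∑' x, A x) :=
    hsum.hasSum.prod_fiberwise fun k => (hS'.hasSum_channel hρ).map (S.coeff k) (hS.continuous k)
  exact (((hS.mul hS').hasSum_channel hρ).unique hdiagonals).trans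
    (hrows.unique (hS.hasSum_channel (hS'.isTraceClass_channel hρ)))

end IsInstrument

end Series

section Moves

variable {m : ℕ}

/-- Loss elements in the modes of a list. -/
def losses (l : List (Fin m)) : Network m := l.map Component.loss

theorem losses_append (l l' : List (Fin m)) : losses (l ++ l') = losses l ++ losses l' :=
  List.map_append

theorem flatten_replicate_uniformLayer (m s : ℕ) :
    (List.replicate s (uniformLayer m)).flatten =
      losses (List.replicate s (List.finRange m)).flatten := by
  simp [uniformLayer, losses, List.map_flatten]

theorem count_flatten_replicate_finRange (s : ℕ) (a : Fin m) :
    (List.replicate s (List.finRange m)).flatten.count a = s := by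
  simp [List.count_flatten, List.count_eq_one_of_mem (List.nodup_finRange m)]

theorem PullsOut.map_eq {β : Type*} {f : Network m → β}
    (hf : ∀ {N N' : Network m}, Move N N' → f N = f N') {N N' : Network m} {s : ℕ}
    (h : PullsOut N s N') :
    f N = f (losses (List.replicate s (List.finRange m)).flatten ++ N') := by
  rw [← flatten_replicate_uniformLayer]
  exact Relation.ReflTransGen.head_induction_on h rfl fun hmove _ ih => (hf hmove).trans ih

end Moves

section NetworkSeries

open Finsupp (single)
open scoped Nat

variable {m : ℕ}

theorem jump_pow_apply (i : Fin m) (k : ℕ) (ρ : FockOp m) (p q : Fin m →₀ ℕ) :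
    (jump i ^ k) ρ p q = (√((p i + k).descFactorial k) : ℝ) * (√((q i + k).descFactorial k) : ℝ) *
      ρ (p + single i k) (q + single i k) := by
  induction k generalizing p q with
  | zero => simp
  | succ k ih =>
    have hdesc (n : ℕ) : √((n + (k + 1)).descFactorial (k + 1)) =
        √(n + 1) * √((n + 1 + k).descFactorial k) := by
      rw [← Real.sqrt_mul (by positivity), Nat.descFactorial_succ,
        show n + (k + 1) - k = n + 1 by omega, show n + (k + 1) = n + 1 + k by omega]
      push_cast
      rfl
    have hmode (n : Fin m →₀ ℕ) : n + single i 1 + single i k = n + single i (k + 1) := by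
      rw [add_assoc, ← Finsupp.single_add, add_comm 1 k]
    rw [pow_succ', Module.End.mul_apply, jump_apply, ih, hdesc, hdesc]
    simp only [Finsupp.add_apply, Finsupp.single_eq_same, hmode, Complex.ofReal_mul]
    ring

theorem weightedJump_single (i : Fin m) (x : ℝ) :
    weightedJump (Pi.single i x) = (x : ℂ) • jump i := by
  rw [weightedJump, Finset.sum_eq_single i (fun c _ hc => by simp [hc]) (by simp),
    Pi.single_eq_same]

theorem lossAmplitude_eq {η : ℝ} (h0 : 0 ≤ η) (h1 : η ≤ 1) (i : Fin m) (k : ℕ)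
    (n : Fin m →₀ ℕ) : lossAmplitude η i k n =
      (√((k ! : ℝ)⁻¹ * (1 - η) ^ k) * (√η ^ n i * √((n i + k).descFactorial k)) : ℝ) := by
  have : 0 ≤ 1 - η := sub_nonneg.2 h1
  have hchoose : ((n i + k).choose k : ℝ) = (k ! : ℝ)⁻¹ * (n i + k).descFactorial k := by
    rw [Nat.descFactorial_eq_factorial_mul_choose, Nat.cast_mul,
      inv_mul_cancel_left₀ (mod_cast k.factorial_ne_zero)]
  have hpow : √η ^ n i = √(η ^ n i) :=
    ((Real.sqrt_eq_iff_eq_sq (by positivity) (by positivity)).2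
      (by rw [← pow_mul, mul_comm, pow_mul, Real.sq_sqrt h0])).symm
  rw [lossAmplitude, hchoose, hpow, ← Real.sqrt_mul (by positivity),
    ← Real.sqrt_mul (by positivity)]
  ring_nf

theorem lossChannel_eq_channel {η : ℝ} (h0 : 0 ≤ η) (h1 : η ≤ 1) (i : Fin m) (ρ : FockOp m) :
    lossChannel η i ρ = channel (lossSeries (Function.update 1 i η)) ρ := by
  have hrate : 1 - Function.update (1 : Fin m → ℝ) i η = Pi.single i (1 - η) := by
    ext c
    rcases eq_or_ne c i with rfl | hc <;> simp [*]
  have hsurvival (n : Fin m →₀ ℕ) :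
      ∏ c, √(Function.update (1 : Fin m → ℝ) i η c) ^ n c = √η ^ n i := by
    rw [Finset.prod_eq_single i (fun c _ hc => by simp [hc]) (by simp), Function.update_self]
  have hsq (k : ℕ) : ((√((k ! : ℝ)⁻¹ * (1 - η) ^ k) : ℝ) : ℂ) * (√((k ! : ℝ)⁻¹ * (1 - η) ^ k) : ℝ) =
      (k ! : ℂ)⁻¹ * ((1 - η : ℝ) : ℂ) ^ k := by
    have := sub_nonneg.2 h1
    rw [← Complex.ofReal_mul, Real.mul_self_sqrt (by positivity)]
    push_cast
    rfl
  ext p q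
  refine tsum_congr fun k => ?_
  rw [coeff_lossSeries, hrate, weightedJump_single, smul_pow, LinearMap.smul_apply,
    Matrix.smul_apply, Module.End.mul_apply, survival_apply, hsurvival, hsurvival,
    LinearMap.smul_apply, Matrix.smul_apply, jump_pow_apply, lossAmplitude_eq h0 h1,
    lossAmplitude_eq h0 h1, Complex.star_def, Complex.conj_ofReal, smul_eq_mul, smul_eq_mul]
  simp only [Complex.ofReal_mul]
  linear_combination (√η ^ p i : ℝ) * (√η ^ q i : ℝ) * (√((p i + k).descFactorial k) : ℝ) *
    (√((q i + k).descFactorial k) : ℝ) * ρ (p + single i k) (q + single i k) * hsq k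

theorem gateChannel_eq_channel (V : Matrix (Fin 2) (Fin 2) ℂ) {i j : Fin m} (hij : i ≠ j)
    (ρ : FockOp m) : gateChannel V i j ρ =
      channel (PowerSeries.C (opticalChannel (modeMatrix V i j))) ρ := by
  ext p q
  rw [gateChannel_eq V hij, channel, tsum_eq_single 0 fun d hd => by
    rw [PowerSeries.coeff_C, if_neg hd]; rfl, PowerSeries.coeff_zero_C]

variable (U : ℕ → Matrix.unitaryGroup (Fin 2) ℂ) (η : ℝ)

/-- The instrument of a component. -/
noncomputable def Component.series : Component m → PowerSeries (Module.End ℂ (FockOp m))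
  | Component.loss i => lossSeries (Function.update 1 i η)
  | Component.split b => PowerSeries.C (opticalChannel (modeMatrix (U b.gate) b.fst b.snd))

/-- The instrument of a network, which counts the photons lost in all its components. Later
components stand on the left, as in the composition of maps. -/
noncomputable def networkSeries (N : Network m) : PowerSeries (Module.End ℂ (FockOp m)) :=
  (N.map (Component.series U η)).reverse.prod

theorem networkSeries_append (N N' : Network m) :
    networkSeries U η (N ++ N') = networkSeries U η N' * networkSeries U η N := by
  simp [networkSeries]

theorem networkSeries_singleton (c : Component m) :
    networkSeries U η [c] = c.series U η := by
  simp [networkSeries]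

variable {η}

theorem networkSeries_losses (h0 : 0 ≤ η) (l : List (Fin m)) :
    networkSeries U η (losses l) = lossSeries fun c => η ^ l.count c := by
  induction l with
  | nil =>
    rw [losses, List.map_nil]
    simpa [networkSeries, Pi.one_def] using lossSeries_one.symm
  | cons i l ih =>
    have hupdate : 0 ≤ Function.update (1 : Fin m → ℝ) i η := fun c => by
      rcases eq_or_ne c i with rfl | hc <;> simp [*]
    rw [losses, List.map_cons, ← losses, ← List.singleton_append, networkSeries_append,
      networkSeries_singleton, ih, Component.series,
      lossSeries_mul (fun c => pow_nonneg h0 _) hupdate]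
    congr 1
    ext c
    rcases eq_or_ne c i with rfl | hc
    · simp [pow_succ]
    · simp [hc, hc.symm]

theorem commute_networkSeries_losses_split (h0 : 0 ≤ η) {l : List (Fin m)} {b : Beamsplitter m}
    (hl : l.count b.fst = l.count b.snd) :
    Commute (networkSeries U η (losses l)) (networkSeries U η [Component.split b]) := by
  rw [networkSeries_losses U h0, networkSeries_singleton]
  exact commute_lossSeries_C
    (survival_commute_opticalChannel _ fun a c =>
      eq_of_modeMatrix_ne_zero (f := fun c => η ^ l.count c) b.ne (by rw [hl]))
    (weightedJump_commute_opticalChannel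
      (modeMatrix_mul_conjTranspose (Matrix.mem_unitaryGroup_iff.1 (U b.gate).2) b.ne)
      fun a c => eq_of_modeMatrix_ne_zero b.ne
        (by rw [Pi.sub_apply, Pi.sub_apply, hl]; rfl))

theorem Move.networkSeries_eq (h0 : 0 ≤ η) {N N' : Network m} (h : Move N N') :
    networkSeries U η N = networkSeries U η N' := by
  have hsplit {l : List (Fin m)} {b : Beamsplitter m} (hl : l.count b.fst = l.count b.snd) :
      networkSeries U η (Component.split b :: losses l) =
        networkSeries U η (losses l ++ [Component.split b]) := by
    rw [← List.singleton_append, networkSeries_append, networkSeries_append,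
      (commute_networkSeries_losses_split U h0 hl).eq]
  cases h with
  | comm A B i j =>
    have : networkSeries U η (losses [i, j]) = networkSeries U η (losses [j, i]) := by
      simp only [networkSeries_losses U h0, (List.Perm.swap j i []).count_eq]
    simp only [networkSeries_append]
    exact congrArg (fun S => _ * (S * _)) this
  | left A B b i hi hi' =>
    have := hsplit (l := [i]) (b := b) (by simp [hi, hi'])
    simp only [networkSeries_append]
    exact congrArg (fun S => _ * (S * _)) this
  | right A B b i hi hi' =>
    have := hsplit (l := [i]) (b := b) (by simp [hi, hi'])
    simp only [networkSeries_append]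
    exact congrArg (fun S => _ * (S * _)) this.symm
  | pull A B b =>
    have := hsplit (l := [b.fst, b.snd]) (b := b) (by simp [b.ne, b.ne.symm])
    simp only [networkSeries_append]
    exact congrArg (fun S => _ * (S * _)) this

theorem PullsOut.networkSeries_eq (h0 : 0 ≤ η) {N N' : Network m} {s : ℕ}
    (h : PullsOut N s N') :
    networkSeries U η N = networkSeries U η N' * lossSeries fun _ => η ^ s := by
  rw [h.map_eq (Move.networkSeries_eq U h0), networkSeries_append, networkSeries_losses U h0]
  simp only [count_flatten_replicate_finRange]

theorem Component.isInstrument_series (h0 : 0 ≤ η) (h1 : η ≤ 1) (c : Component m) :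
    IsInstrument (c.series U η) := by
  cases c with
  | loss i =>
    refine isInstrument_lossSeries (fun c => ?_) fun c => ?_ <;>
      rcases eq_or_ne c i with rfl | hc <;> simp [*]
  | split b =>
    exact isInstrument_opticalChannel
      (modeMatrix_mul_conjTranspose (Matrix.mem_unitaryGroup_iff.1 (U b.gate).2) b.ne)

theorem Component.channel_eq (h0 : 0 ≤ η) (h1 : η ≤ 1) (c : Component m) (ρ : FockOp m) :
    c.channel U η ρ = LossyOptics.channel (c.series U η) ρ := by
  cases c with
  | loss i => exact lossChannel_eq_channel h0 h1 i ρ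
  | split b => exact gateChannel_eq_channel _ b.ne ρ

theorem isInstrument_networkSeries (h0 : 0 ≤ η) (h1 : η ≤ 1) (N : Network m) :
    IsInstrument (networkSeries U η N) := by
  induction N with
  | nil => exact .one
  | cons c N ih =>
    rw [← List.singleton_append, networkSeries_append, networkSeries_singleton]
    exact ih.mul (c.isInstrument_series U h0 h1)

theorem networkChannel_eq_channel (h0 : 0 ≤ η) (h1 : η ≤ 1) (N : Network m) {ρ : FockOp m}
    (hρ : IsTraceClass ρ) :
    networkChannel U η N ρ = channel (networkSeries U η N) ρ := by
  induction N using List.reverseRecOn with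
  | nil =>
    ext p q
    rw [channel, tsum_eq_single 0 fun d hd => by
      simp [networkSeries, PowerSeries.coeff_one, hd]]
    simp [networkSeries, networkChannel]
  | append_singleton N c ih =>
    rw [networkSeries_append, networkSeries_singleton, (c.isInstrument_series U h0 h1).channel_mul
      (isInstrument_networkSeries U h0 h1 N) hρ, ← ih, ← c.channel_eq U h0 h1, networkChannel,
      List.foldl_concat, networkChannel]

end NetworkSeries

theorem uniformLoss_eq_channel {m : ℕ} {η : ℝ} (h0 : 0 ≤ η) (h1 : η ≤ 1) {ρ : FockOp m}
    (hρ : IsTraceClass ρ) : uniformLoss η ρ = channel (lossSeries fun _ => η) ρ := by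
  have hnetwork : uniformLoss η ρ = networkChannel 1 η (losses (List.finRange m)) ρ := by
    rw [networkChannel, losses, List.foldl_map]
    rfl
  rw [hnetwork, networkChannel_eq_channel 1 h0 h1 _ hρ, networkSeries_losses 1 h0]
  simp [List.nodup_finRange]

theorem PullsOut.networkChannel_eq {m : ℕ} {N N' : Network m} {s : ℕ} (h : PullsOut N s N')
    (U : ℕ → Matrix.unitaryGroup (Fin 2) ℂ) {η : ℝ} (h0 : 0 ≤ η) (h1 : η ≤ 1) {ρ : FockOp m}
    (hρ : IsTraceClass ρ) :
    networkChannel U η N ρ = networkChannel U η N' (uniformLoss (η ^ s) ρ) := by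
  have hs0 : 0 ≤ η ^ s := pow_nonneg h0 s
  have hs1 : η ^ s ≤ 1 := pow_le_one₀ h0 h1
  have huniform : IsInstrument (lossSeries fun _ : Fin m => η ^ s) :=
    isInstrument_lossSeries (fun _ => hs0) fun _ => hs1
  rw [networkChannel_eq_channel U h0 h1 N hρ, h.networkSeries_eq U h0,
    (isInstrument_networkSeries U h0 h1 N').channel_mul huniform hρ,
    uniformLoss_eq_channel hs0 hs1 hρ,
    networkChannel_eq_channel U h0 h1 N' (huniform.isTraceClass_channel hρ)]

section Distances

variable {m : ℕ}

/-- The smallest number of the beamsplitters `bs` on a path that starts in mode `a`. -/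
def outDist : List (Beamsplitter m) → Fin m → ℕ
  | [], _ => 0
  | b :: bs, a =>
    if a = b.fst ∨ a = b.snd then min (outDist bs b.fst) (outDist bs b.snd) + 1 else outDist bs a

theorem outDist_le_length (bs : List (Beamsplitter m)) (a : Fin m) :
    outDist bs a ≤ bs.length := by
  induction bs generalizing a with
  | nil => exact le_rfl
  | cons b bs ih =>
    rw [outDist, List.length_cons]
    split_ifs
    · exact Nat.succ_le_succ (min_le_of_left_le (ih _))
    · exact (ih a).trans (Nat.le_succ _)

theorem exists_pathCrosses_outDist (bs : List (Beamsplitter m)) (a : Fin m) :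
    ∃ c, PathCrosses (lossyNetwork bs) a c (outDist bs a) := by
  induction bs generalizing a with
  | nil => exact ⟨a, .nil a⟩
  | cons b bs ih =>
    rw [outDist]
    split_ifs with ha
    · obtain ⟨a', ha', hmin⟩ : ∃ a', (a' = b.fst ∨ a' = b.snd) ∧
          min (outDist bs b.fst) (outDist bs b.snd) = outDist bs a' := by
        rcases min_choice (outDist bs b.fst) (outDist bs b.snd) with h | h
        exacts [⟨_, .inl rfl, h⟩, ⟨_, .inr rfl, h⟩]
      obtain ⟨c, hc⟩ := ih a'
      exact ⟨c, .loss _ (.loss _ (.cross b ha ha' (hmin ▸ hc)))⟩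
    · obtain ⟨c, hc⟩ := ih a
      obtain ⟨hfst, hsnd⟩ := not_or.1 ha
      exact ⟨c, .loss _ (.loss _ (.pass b hfst hsnd hc))⟩

theorem outDist_le_of_pathCrosses {bs : List (Beamsplitter m)} {a c : Fin m} {k : ℕ}
    (h : PathCrosses (lossyNetwork bs) a c k) : outDist bs a ≤ k := by
  induction bs generalizing a k with
  | nil => exact Nat.zero_le k
  | cons b bs ih =>
    rw [outDist]
    obtain _ | ⟨_, _ | ⟨_, h⟩⟩ := h
    cases h with
    | pass _ hfst hsnd h => exact (if_neg (not_or.2 ⟨hfst, hsnd⟩)).trans_le (ih h)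
    | cross _ ha ha' h =>
      rw [if_pos ha]
      rcases ha' with rfl | rfl
      exacts [Nat.succ_le_succ (min_le_of_left_le (ih h)),
        Nat.succ_le_succ (min_le_of_right_le (ih h))]

theorem isLeast_range_outDist {bs : List (Beamsplitter m)} {s : ℕ}
    (hs : IsLeast {k | ∃ a c : Fin m, PathCrosses (lossyNetwork bs) a c k} s) :
    IsLeast (Set.range (outDist bs)) s := by
  have hle (a : Fin m) : s ≤ outDist bs a := hs.2 ⟨a, exists_pathCrosses_outDist bs a⟩
  obtain ⟨a, c, h⟩ := hs.1
  exact ⟨⟨a, (outDist_le_of_pathCrosses h).antisymm (hle a)⟩, Set.forall_mem_range.2 hle⟩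

end Distances

section PullingOut

variable {m : ℕ}

/-- `f a` loss elements in each mode `a`. -/
def lossLayers (f : Fin m → ℕ) : List (Fin m) :=
  (List.finRange m).flatMap fun a => List.replicate (f a) a

theorem count_lossLayers (f : Fin m → ℕ) (a : Fin m) : (lossLayers f).count a = f a := by
  rw [lossLayers, List.count_flatMap, List.sum_map_eq_nsmul_single a]
  · simp [List.count_eq_one_of_mem (List.nodup_finRange m)]
  · intro c hc _
    simp [List.count_replicate, hc]

/-- What remains of the network built from the beamsplitters `bs` when all loss elements that can be
moved to the input are removed: the surplus in one of the two output arms of each beamsplitter. -/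
def lossyCore : List (Beamsplitter m) → Network m
  | [] => []
  | b :: bs => Component.split b ::
      (losses (List.replicate (outDist bs b.fst - outDist bs b.snd) b.fst ++
        List.replicate (outDist bs b.snd - outDist bs b.fst) b.snd) ++ lossyCore bs)

/-- What remains of the network built from the beamsplitters `bs` when `s` uniform layers of losses
are pulled out of it. -/
def reducedNetwork (bs : List (Beamsplitter m)) (s : ℕ) : Network m :=
  losses (lossLayers fun a => outDist bs a - s) ++ lossyCore bs

/-- Loss elements can be moved such that the first network becomes the second. -/
abbrev Moves : Network m → Network m → Prop := Relation.ReflTransGen Move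

theorem Move.context (A B : Network m) {N N' : Network m} (h : Move N N') :
    Move (A ++ N ++ B) (A ++ N' ++ B) := by
  cases h with
  | comm A' B' i j => simpa using Move.comm (A ++ A') (B' ++ B) i j
  | left A' B' b i hi hi' => simpa using Move.left (A ++ A') (B' ++ B) b i hi hi'
  | right A' B' b i hi hi' => simpa using Move.right (A ++ A') (B' ++ B) b i hi hi'
  | pull A' B' b => simpa using Move.pull (A ++ A') (B' ++ B) b

theorem Moves.append_left (A : Network m) {N N' : Network m} (h : Moves N N') :
    Moves (A ++ N) (A ++ N') :=
  h.lift (A ++ ·) fun _ _ h => by simpa using h.context A []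

theorem Moves.append_right {N N' : Network m} (h : Moves N N') (B : Network m) :
    Moves (N ++ B) (N' ++ B) :=
  h.lift (· ++ B) fun _ _ h => h.context [] B

theorem moves_losses_of_perm {l l' : List (Fin m)} (h : l.Perm l') :
    Moves (losses l) (losses l') := by
  induction h with
  | nil => exact .refl
  | cons a _ ih => exact ih.append_left [Component.loss a]
  | swap a c l => exact .single (Move.comm [] (losses l) c a)
  | trans _ _ ih ih' => exact ih.trans ih'

theorem moves_losses_of_count {l l' : List (Fin m)} (h : ∀ a, l.count a = l'.count a) :
    Moves (losses l) (losses l') :=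
  moves_losses_of_perm (List.perm_iff_count.2 h)

/-- Loss elements in the modes `l` at the output of the beamsplitter `b` can be moved to its
input. -/
def Passes (b : Beamsplitter m) (l : List (Fin m)) : Prop :=
  Moves (Component.split b :: losses l) (losses l ++ [Component.split b])

theorem Passes.append {b : Beamsplitter m} {l l' : List (Fin m)} (h : Passes b l)
    (h' : Passes b l') : Passes b (l ++ l') := by
  have hstep := (h.append_right (losses l')).trans
    (by simpa using h'.append_left (losses l))
  simpa [Passes, losses_append] using hstep

theorem Passes.of_perm {b : Beamsplitter m} {l l' : List (Fin m)} (h : Passes b l')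
    (hl : l.Perm l') : Passes b l :=
  ((moves_losses_of_perm hl).append_left [Component.split b]).trans
    (h.trans ((moves_losses_of_perm hl.symm).append_right _))

theorem Passes.of_forall_mem {b : Beamsplitter m} {l : List (Fin m)}
    (hl : ∀ i ∈ l, i ≠ b.fst ∧ i ≠ b.snd) : Passes b l := by
  induction l with
  | nil => exact .refl
  | cons i l ih =>
    have hi : Passes b [i] := .single (Move.left [] [] b i (hl i (by simp)).1 (hl i (by simp)).2)
    exact hi.append (ih fun j hj => hl j (List.mem_cons_of_mem i hj))

theorem Passes.pairs (b : Beamsplitter m) (k : ℕ) :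
    Passes b (List.replicate k [b.fst, b.snd]).flatten := by
  induction k with
  | zero => exact .refl
  | succ k ih =>
    have hpair : Passes b [b.fst, b.snd] := .single (Move.pull [] [] b)
    exact hpair.append ih

theorem Passes.of_count_eq {b : Beamsplitter m} {l : List (Fin m)}
    (hl : l.count b.fst = l.count b.snd) : Passes b l := by
  refine ((Passes.of_forall_mem (l := l.filter fun i => i ≠ b.fst ∧ i ≠ b.snd) ?_).append
    (Passes.pairs b (l.count b.fst))).of_perm (List.perm_iff_count.2 fun a => ?_)
  · simp
  · have hne := b.ne
    rcases eq_or_ne a b.fst with rfl | hfst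
    · simp [List.count_flatten, hne.symm, List.count_eq_zero]
    rcases eq_or_ne a b.snd with rfl | hsnd
    · simp [List.count_flatten, hne, hl, List.count_eq_zero]
    · simp [List.count_flatten, List.count_filter, hfst, hsnd, hfst.symm, hsnd.symm]

theorem moves_lossyNetwork (bs : List (Beamsplitter m)) :
    Moves (lossyNetwork bs) (losses (lossLayers (outDist bs)) ++ lossyCore bs) := by
  induction bs with
  | nil =>
    have : lossLayers (outDist ([] : List (Beamsplitter m))) = [] := by simp [lossLayers, outDist]
    rw [this]
    exact .refl
  | cons b bs ih =>
    let f := outDist bs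
    let balanced := lossLayers fun a =>
      if a = b.fst ∨ a = b.snd then min (f b.fst) (f b.snd) else f a
    let surplus := List.replicate (f b.fst - f b.snd) b.fst ++
      List.replicate (f b.snd - f b.fst) b.snd
    have hne := b.ne
    have hbalanced : Passes b balanced := .of_count_eq (by simp [balanced, count_lossLayers])
    have hsplit (a : Fin m) : (lossLayers f).count a = (balanced ++ surplus).count a := by
      simp only [balanced, surplus, List.count_append, count_lossLayers, List.count_replicate,
        beq_iff_eq]
      grind
    have hcollect (a : Fin m) :
        ([b.fst, b.snd] ++ balanced).count a = (lossLayers (outDist (b :: bs))).count a := by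
      simp only [balanced, f, List.count_append, count_lossLayers, List.count_cons,
        List.count_nil, beq_iff_eq, outDist]
      grind
    have hinput : Moves (lossyNetwork (b :: bs))
        (block b ++ (losses (balanced ++ surplus) ++ lossyCore bs)) :=
      Moves.append_left (block b) (ih.trans ((moves_losses_of_count hsplit).append_right _))
    have hpass : Moves (block b ++ (losses (balanced ++ surplus) ++ lossyCore bs))
        (losses ([b.fst, b.snd] ++ balanced) ++ lossyCore (b :: bs)) := by
      have := (Moves.append_left (losses [b.fst, b.snd]) hbalanced).append_right
        (losses surplus ++ lossyCore bs)
      simpa [block, losses, lossyCore, surplus, f] using this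
    exact (hinput.trans hpass).trans ((moves_losses_of_count hcollect).append_right _)

theorem pullsOut_reducedNetwork {bs : List (Beamsplitter m)} {s : ℕ}
    (hs : ∀ a, s ≤ outDist bs a) : PullsOut (lossyNetwork bs) s (reducedNetwork bs s) := by
  refine (moves_lossyNetwork bs).trans ?_
  rw [reducedNetwork, flatten_replicate_uniformLayer, ← List.append_assoc, ← losses_append]
  refine (moves_losses_of_count fun a => ?_).append_right _
  rw [List.count_append, count_flatten_replicate_finRange, count_lossLayers, count_lossLayers,
    Nat.add_sub_cancel' (hs a)]

theorem PullsOut.beamsplitters_eq {N N' : Network m} {s : ℕ} (h : PullsOut N s N') :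
    beamsplitters N = beamsplitters N' := by
  rw [h.map_eq (f := beamsplitters) fun hmove => by cases hmove <;> simp [beamsplitters]]
  simp [beamsplitters, losses, List.filterMap_map]

theorem PullsOut.lossCount_eq {N N' : Network m} {s : ℕ} (h : PullsOut N s N') :
    lossCount N = lossCount N' + s * m := by
  rw [h.map_eq (f := lossCount) fun hmove => by cases hmove <;> simp [lossCount]]
  simp [lossCount, losses, List.countP_map, Function.comp_def, add_comm]

theorem beamsplitters_lossyNetwork (bs : List (Beamsplitter m)) :
    beamsplitters (lossyNetwork bs) = bs := by
  simp [beamsplitters, lossyNetwork, block, List.filterMap_flatMap]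

end PullingOut

section TimedHoareLogic

/-- The time-bounded Hoare triple: started with memory `σ`, the program `P` halts within `t` steps
with a memory that satisfies `Q`. -/
def HaltsWithin (P : Program) (σ : Store) (t : ℕ) (Q : Store → Prop) : Prop :=
  ∃ σ' t', t' ≤ t ∧ Runs P σ σ' t' ∧ Q σ'

variable {P P' : Program} {σ : Store} {t u : ℕ} {Q R : Store → Prop}

theorem HaltsWithin.mono (h : HaltsWithin P σ t Q) (htu : t ≤ u) (hQ : ∀ σ', Q σ' → R σ') :
    HaltsWithin P σ u R :=
  let ⟨σ', t', ht', hrun, hσ'⟩ := h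
  ⟨σ', t', ht'.trans htu, hrun, hQ σ' hσ'⟩

theorem HaltsWithin.seq (h : HaltsWithin P σ t Q) (h' : ∀ σ', Q σ' → HaltsWithin P' σ' u R) :
    HaltsWithin (.seq P P') σ (t + u) R :=
  let ⟨σ', t', ht', hrun, hσ'⟩ := h
  let ⟨σ'', u', hu', hrun', hσ''⟩ := h' σ' hσ'
  ⟨σ'', t' + u', Nat.add_le_add ht' hu', .seq hrun hrun', hσ''⟩

theorem haltsWithin_set (r : ℕ) (e : Expr) (σ : Store) :
    HaltsWithin (.set r e) σ (e.cost + 1)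
      (· = { σ with reg := Function.update σ.reg r (e.eval σ) }) :=
  ⟨_, _, le_rfl, .set r e σ, rfl⟩

theorem haltsWithin_put (A : ℕ) (e₁ e₂ : Expr) (σ : Store) :
    HaltsWithin (.put A e₁ e₂) σ (e₁.cost + e₂.cost + 1)
      (· = { σ with arr :=
        Function.update σ.arr A (Function.update (σ.arr A) (e₁.eval σ) (e₂.eval σ)) }) :=
  ⟨_, _, le_rfl, .put A e₁ e₂ σ, rfl⟩

theorem haltsWithin_loop (I : ℕ → Store → Prop) {e₁ e₂ : Expr} {n : ℕ}
    (hstep : ∀ k < n, ∀ σ, I k σ → e₁.eval σ < e₂.eval σ ∧ HaltsWithin P σ t (I (k + 1)))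
    (hexit : ∀ σ, I n σ → ¬ e₁.eval σ < e₂.eval σ) (h0 : I 0 σ) :
    HaltsWithin (.loop e₁ e₂ P) σ
      (n * (e₁.cost + e₂.cost + 1 + t) + (e₁.cost + e₂.cost + 1)) (I n) := by
  suffices h : ∀ d k σ, k + d = n → I k σ → HaltsWithin (.loop e₁ e₂ P) σ
      (d * (e₁.cost + e₂.cost + 1 + t) + (e₁.cost + e₂.cost + 1)) (I n) from
    h n 0 σ (Nat.zero_add n) h0
  intro d
  induction d with
  | zero =>
    rintro k σ rfl hI
    exact ⟨σ, _, by omega, .loop_false (hexit σ hI), hI⟩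
  | succ d ih =>
    intro k σ hk hI
    obtain ⟨hlt, σ', t', ht', hrun, hI'⟩ := hstep k (by omega) σ hI
    obtain ⟨σ'', u, hu, hrun', hI''⟩ := ih (k + 1) σ' (by omega) hI'
    refine ⟨σ'', _, ?_, .loop_true hlt hrun hrun', hI''⟩
    rw [Nat.succ_mul]
    omega

end TimedHoareLogic

section Output

variable {P P' : Program} {σ σ' σ'' : Store} {l l' : List ℕ} {t u : ℕ}

/-- The list `l` has been output: it stands in array `1`, and its length in register `1`. -/
def Outputs (σ : Store) (l : List ℕ) : Prop :=
  σ.reg 1 = l.length ∧ ∀ k < l.length, σ.arr 1 k = l.getD k 0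

/-- From the memory `σ` to the memory `σ'`, the list `l` has been appended to the output, and
register `4`, the counter of loops that write, is the only other thing that may have changed. -/
structure Appends (l : List ℕ) (σ σ' : Store) : Prop where
  outputs : ∀ {out}, Outputs σ out → Outputs σ' (out ++ l)
  reg_eq : ∀ r, r ≠ 1 → r ≠ 4 → σ'.reg r = σ.reg r
  arr_eq : ∀ A, A ≠ 1 → σ'.arr A = σ.arr A

theorem Appends.refl (σ : Store) : Appends [] σ σ where
  outputs h := by rwa [List.append_nil]
  reg_eq _ _ _ := rfl
  arr_eq _ _ := rfl

theorem Appends.trans (h : Appends l σ σ') (h' : Appends l' σ' σ'') :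
    Appends (l ++ l') σ σ'' where
  outputs hout := by simpa using h'.outputs (h.outputs hout)
  reg_eq r hr hr' := (h'.reg_eq r hr hr').trans (h.reg_eq r hr hr')
  arr_eq A hA := (h'.arr_eq A hA).trans (h.arr_eq A hA)

theorem Appends.set_counter (h : Appends l σ σ') (c : ℕ) :
    Appends l σ { σ' with reg := Function.update σ'.reg 4 c } where
  outputs hout := by simpa [Outputs] using h.outputs hout
  reg_eq r hr hr' := by simpa [hr'] using h.reg_eq r hr hr'
  arr_eq := h.arr_eq

/-- The expression reads neither the output nor the counter. -/
def Expr.Stable : Expr → Prop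
  | .const _ => True
  | .var r => r ≠ 1 ∧ r ≠ 4
  | .add e₁ e₂ => e₁.Stable ∧ e₂.Stable
  | .sub e₁ e₂ => e₁.Stable ∧ e₂.Stable
  | .get A e => A ≠ 1 ∧ e.Stable

theorem Expr.Stable.eval_eq {e : Expr} (he : e.Stable) (h : Appends l σ σ') :
    e.eval σ' = e.eval σ := by
  induction e with
  | const n => rfl
  | var r => exact h.reg_eq r he.1 he.2
  | add e₁ e₂ ih₁ ih₂ => exact congrArg₂ (· + ·) (ih₁ he.1) (ih₂ he.2)
  | sub e₁ e₂ ih₁ ih₂ => exact congrArg₂ (· - ·) (ih₁ he.1) (ih₂ he.2)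
  | get A e ih => rw [Expr.eval, Expr.eval, h.arr_eq A he.1, ih he.2]

/-- Whatever has been output since the memory was `σ`, the program `P` appends `l` to the output
within `t` steps. -/
def Writes (σ : Store) (P : Program) (l : List ℕ) (t : ℕ) : Prop :=
  ∀ l₀ σ', Appends l₀ σ σ' → HaltsWithin P σ' t (Appends l σ')

theorem Writes.haltsWithin (h : Writes σ P l t) : HaltsWithin P σ t (Appends l σ) :=
  h [] σ (.refl σ)

theorem Writes.mono (h : Writes σ P l t) (htu : t ≤ u) : Writes σ P l u := fun l₀ σ' hσ' =>
  (h l₀ σ' hσ').mono htu fun _ => id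

theorem Writes.seq (h : Writes σ P l t) (h' : Writes σ P' l' u) :
    Writes σ (.seq P P') (l ++ l') (t + u) := fun l₀ σ₁ hσ₁ =>
  (h l₀ σ₁ hσ₁).seq fun σ₂ hσ₂ => (h' _ σ₂ (hσ₁.trans hσ₂)).mono le_rfl fun _ => hσ₂.trans

/-- Append the value of an expression to the output. -/
def emit (e : Expr) : Program :=
  .seq (.put 1 (.var 1) e) (.set 1 (.add (.var 1) (.const 1)))

theorem haltsWithin_emit (e : Expr) (σ : Store) :
    HaltsWithin (emit e) σ (e.cost + 6) fun σ' => Appends [e.eval σ] σ σ' ∧ σ'.reg 4 = σ.reg 4 := by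
  refine ((haltsWithin_put 1 (.var 1) e σ).seq fun σ₁ h₁ => (haltsWithin_set 1 _ σ₁).mono le_rfl
    fun σ₂ h₂ => ?_).mono (by simp only [Expr.cost]; omega) fun _ => id
  subst h₁ h₂
  refine ⟨⟨fun {out} ⟨hlen, hget⟩ => ⟨by simp [Expr.eval, hlen], fun k hk => ?_⟩,
    fun r hr _ => by simp [hr], fun A hA => by simp [hA]⟩, by simp⟩
  rw [List.length_append, List.length_singleton, Nat.lt_succ_iff_lt_or_eq] at hk
  rcases hk with hk | rfl
  · simpa [Expr.eval, hlen, hk.ne, List.getElem?_append_left hk] using hget k hk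
  · simp [Expr.eval, hlen]

theorem writes_emit {e : Expr} (he : e.Stable) (σ : Store) :
    Writes σ (emit e) [e.eval σ] (e.cost + 6) := fun _ σ' hσ' => by
  rw [← he.eval_eq hσ']
  exact (haltsWithin_emit e σ').mono le_rfl fun _ h => h.1

/-- Append to the output the descriptions of `n` loss elements in mode `e`. -/
def emitLosses (n e : Expr) : Program :=
  .seq (.set 4 n) (.loop (.const 0) (.var 4)
    (.seq (emit (.const 0)) (.seq (emit e) (.set 4 (.sub (.var 4) (.const 1))))))

theorem writes_emitLosses {n e : Expr} (hn : n.Stable) (he : e.Stable) (σ : Store) :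
    Writes σ (emitLosses n e) (List.replicate (n.eval σ) [0, e.eval σ]).flatten
      (n.eval σ * (e.cost + 20) + n.cost + 4) := fun _ σ' hσ' => by
  rw [← hn.eval_eq hσ', ← he.eval_eq hσ']
  set c := n.eval σ'
  let I (k : ℕ) (τ : Store) : Prop :=
    Appends (List.replicate k [0, e.eval σ']).flatten σ' τ ∧ τ.reg 4 = c - k
  have hstep : ∀ k < c, ∀ τ, I k τ → (Expr.const 0).eval τ < (Expr.var 4).eval τ ∧
      HaltsWithin (.seq (emit (.const 0)) (.seq (emit e) (.set 4 (.sub (.var 4) (.const 1))))) τ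
        (e.cost + 17) (I (k + 1)) := by
    rintro k hk τ ⟨happ, hcount⟩
    refine ⟨by simpa [Expr.eval, hcount] using hk, ((haltsWithin_emit _ τ).seq fun τ₁ h₁ =>
      (haltsWithin_emit _ τ₁).seq fun τ₂ h₂ => haltsWithin_set _ _ τ₂ |>.mono le_rfl
        (R := I (k + 1)) ?_).mono (by simp only [Expr.cost]; omega) fun _ => id⟩
    rintro _ rfl
    have := (happ.trans (h₁.1.trans h₂.1)).set_counter (c - (k + 1))
    rw [he.eval_eq (happ.trans h₁.1)] at this
    refine ⟨?_, by simp [Expr.eval, h₂.2, h₁.2, hcount, Nat.sub_sub]⟩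
    simpa [Expr.eval, h₂.2, h₁.2, hcount, Nat.sub_sub, List.replicate_succ'] using this
  refine ((haltsWithin_set 4 n σ').seq fun τ hτ => haltsWithin_loop I hstep ?_ ?_).mono
    (by simp only [Expr.cost]; ring_nf; omega) fun _ h => h.1
  · rintro τ ⟨-, hcount⟩
    simp [Expr.eval, hcount]
  · subst hτ
    exact ⟨(Appends.refl σ').set_counter c, by simp [c]⟩

end Output

section Descriptions

theorem getD_flatMap_of_length_eq {α β : Type*} {f : α → List β} {n : ℕ}
    (hf : ∀ a, (f a).length = n) {l : List α} {i j : ℕ} (hi : i < l.length) (hj : j < n) (d : β) :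
    (l.flatMap f).getD (n * i + j) d = (f l[i]).getD j d := by
  induction l generalizing i with
  | nil => exact absurd hi (Nat.not_lt_zero i)
  | cons a l ih =>
    rw [List.flatMap_cons]
    cases i with
    | zero => rw [Nat.mul_zero, Nat.zero_add, List.getD_append _ _ _ _ (hj.trans_eq (hf a).symm),
        List.getElem_cons_zero]
    | succ i =>
      rw [List.getD_append_right _ _ _ _ (by rw [hf a, Nat.mul_succ]; omega), hf a,
        show n * (i + 1) + j - n = n * i + j by rw [Nat.mul_succ]; omega]
      exact ih (Nat.lt_of_succ_lt_succ hi)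

variable {m : ℕ}

theorem describe_lossyNetwork (bs : List (Beamsplitter m)) :
    describe (lossyNetwork bs) = m :: bs.flatMap fun b => (block b).flatMap Component.words := by
  rw [describe, lossyNetwork, List.flatMap_assoc]

theorem length_describe_lossyNetwork (bs : List (Beamsplitter m)) :
    (describe (lossyNetwork bs)).length = 1 + 8 * bs.length := by
  simp [describe_lossyNetwork, block, Component.words, List.length_flatMap, add_comm, mul_comm]

theorem getD_describe_lossyNetwork {bs : List (Beamsplitter m)} {i j : ℕ} (hi : i < bs.length)
    (hj : j < 8) :
    (describe (lossyNetwork bs)).getD (1 + 8 * i + j) 0 =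
      ((block bs[i]).flatMap Component.words).getD j 0 := by
  rw [describe_lossyNetwork, add_assoc, add_comm 1, List.getD_cons_succ]
  exact getD_flatMap_of_length_eq (n := 8) (fun _ => rfl) hi hj 0

theorem words_losses_replicate (c : ℕ) (i : Fin m) :
    (losses (List.replicate c i)).flatMap Component.words =
      (List.replicate c [0, (i : ℕ)]).flatten := by
  simp [losses, List.flatMap, Component.words]

theorem words_lossLayers (f : Fin m → ℕ) :
    (losses (lossLayers f)).flatMap Component.words =
      (List.finRange m).flatMap fun a => (List.replicate (f a) [0, (a : ℕ)]).flatten := by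
  simp only [← words_losses_replicate, lossLayers, losses, List.map_flatMap, List.flatMap_assoc]

theorem words_lossyCore_cons (b : Beamsplitter m) (bs : List (Beamsplitter m)) :
    (lossyCore (b :: bs)).flatMap Component.words =
      [1, (b.fst : ℕ), (b.snd : ℕ), b.gate] ++
        ((List.replicate (outDist bs b.fst - outDist bs b.snd) [0, (b.fst : ℕ)]).flatten ++
          (List.replicate (outDist bs b.snd - outDist bs b.fst) [0, (b.snd : ℕ)]).flatten) ++
        (lossyCore bs).flatMap Component.words := by
  rw [lossyCore, List.flatMap_cons, List.flatMap_append, losses_append, List.flatMap_append,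
    words_losses_replicate, words_losses_replicate, ← List.append_assoc, Component.words]

theorem describe_reducedNetwork (bs : List (Beamsplitter m)) (s : ℕ) :
    describe (reducedNetwork bs s) =
      m :: ((List.finRange m).flatMap fun a =>
        (List.replicate (outDist bs a - s) [0, (a : ℕ)]).flatten) ++
        (lossyCore bs).flatMap Component.words := by
  rw [describe, reducedNetwork, List.flatMap_append, words_lossLayers, List.cons_append]

end Descriptions

section Algorithm

/-- The word with the first mode of the beamsplitter of the current block. -/
def fstWord : Expr := .get 0 (.add (.var 0) (.const 5))

/-- The word with the second mode of the beamsplitter of the current block. -/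
def sndWord : Expr := .get 0 (.add (.var 0) (.const 6))

/-- The word with the name of the unitary of the beamsplitter of the current block. -/
def gateWord : Expr := .get 0 (.add (.var 0) (.const 7))

/-- Go back to the preceding block, store the surplus in both output arms of its beamsplitter, and
update the distances. -/
def backwardStep : Program :=
  .seq (.set 0 (.sub (.var 0) (.const 8)))
    (.seq (.put 3 (.var 0) (.sub (.get 2 fstWord) (.get 2 sndWord)))
      (.seq (.put 4 (.var 0) (.sub (.get 2 sndWord) (.get 2 fstWord)))
        (.seq (.put 2 fstWord (.add (.sub (.get 2 fstWord) (.get 3 (.var 0))) (.const 1)))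
          (.put 2 sndWord (.get 2 fstWord)))))

/-- Compute the distances from the last block to the first one. -/
def backwardPass : Program :=
  .seq (.set 5 (.var 0)) (.loop (.const 1) (.var 0) backwardStep)

/-- Replace the number of layers by the distance of the current mode if that is smaller. The
minimum of `x` and `y` is computed as `x - (x - y)`. -/
def minimumStep : Program :=
  .seq (.set 2 (.sub (.var 2) (.sub (.var 2) (.get 2 (.var 3)))))
    (.set 3 (.add (.var 3) (.const 1)))

/-- Compute the number of layers, the minimum of the distances. -/
def minimumPass : Program :=
  .seq (.set 2 (.get 2 (.const 0)))
    (.seq (.set 3 (.const 0)) (.loop (.var 3) (.get 0 (.const 0)) minimumStep))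

/-- Write the loss elements that remain at the input of the current mode. -/
def inputStep : Program :=
  .seq (emitLosses (.sub (.get 2 (.var 3)) (.var 2)) (.var 3)) (.set 3 (.add (.var 3) (.const 1)))

/-- Write the number of modes and the loss elements that remain at the input. -/
def inputPass : Program :=
  .seq (emit (.get 0 (.const 0)))
    (.seq (.set 3 (.const 0)) (.loop (.var 3) (.get 0 (.const 0)) inputStep))

/-- Write the beamsplitter of the current block and the surplus in its output arms. -/
def writeBlock : Program :=
  .seq (.seq (emit (.const 1)) (.seq (emit fstWord) (.seq (emit sndWord) (emit gateWord))))
    (.seq (emitLosses (.get 3 (.var 0)) fstWord) (emitLosses (.get 4 (.var 0)) sndWord))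

/-- Write the current block and go to the next one. -/
def forwardStep : Program :=
  .seq writeBlock (.set 0 (.add (.var 0) (.const 8)))

/-- Write what remains of all blocks. -/
def forwardPass : Program :=
  .loop (.var 0) (.var 5) forwardStep

/-- The program that pulls the losses out of a network built from lossy beamsplitters, each of which
is a block of eight words of the description. The registers hold the position of the current block
(`0`), the length of the output (`1`), the number of layers (`2`), the current mode (`3`), a counter
(`4`) and the length of the input (`5`); the arrays hold the input (`0`), the output (`1`), the
distances of the modes (`2`) and the surplus in the first and in the second output arm of each
beamsplitter (`3` and `4`), at the position of its block. -/
def pullOutProgram : Program :=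
  .seq backwardPass (.seq minimumPass (.seq inputPass forwardPass))

variable {m : ℕ} {bs : List (Beamsplitter m)} {σ σ' : Store} {i s : ℕ} {l : List ℕ}

/-- The memory holds the words of the input that the program reads, the distances of the modes at
the input of beamsplitter number `i`, and the surplus in the output arms of the beamsplitters from
number `i` on. -/
structure HoldsData (bs : List (Beamsplitter m)) (i : ℕ) (σ : Store) : Prop where
  modes : σ.arr 0 0 = m
  fst : ∀ (j : ℕ) (hj : j < bs.length), σ.arr 0 (1 + 8 * j + 5) = bs[j].fst
  snd : ∀ (j : ℕ) (hj : j < bs.length), σ.arr 0 (1 + 8 * j + 6) = bs[j].snd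
  gate : ∀ (j : ℕ) (hj : j < bs.length), σ.arr 0 (1 + 8 * j + 7) = bs[j].gate
  size : σ.reg 5 = 1 + 8 * bs.length
  dist : ∀ a : Fin m, σ.arr 2 a = outDist (bs.drop i) a
  fstSurplus : ∀ (j : ℕ) (hj : j < bs.length), i ≤ j → σ.arr 3 (1 + 8 * j) =
    outDist (bs.drop (j + 1)) bs[j].fst - outDist (bs.drop (j + 1)) bs[j].snd
  sndSurplus : ∀ (j : ℕ) (hj : j < bs.length), i ≤ j → σ.arr 4 (1 + 8 * j) =
    outDist (bs.drop (j + 1)) bs[j].snd - outDist (bs.drop (j + 1)) bs[j].fst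

theorem HoldsData.congr (h : HoldsData bs i σ) (hreg : σ'.reg 5 = σ.reg 5)
    (harr : ∀ A, A ≠ 1 → σ'.arr A = σ.arr A) : HoldsData bs i σ' where
  modes := by rw [harr 0 (by decide), h.modes]
  fst j hj := by rw [harr 0 (by decide), h.fst j hj]
  snd j hj := by rw [harr 0 (by decide), h.snd j hj]
  gate j hj := by rw [harr 0 (by decide), h.gate j hj]
  size := hreg.trans h.size
  dist a := by rw [harr 2 (by decide), h.dist a]
  fstSurplus j hj hij := by rw [harr 3 (by decide), h.fstSurplus j hj hij]
  sndSurplus j hj hij := by rw [harr 4 (by decide), h.sndSurplus j hj hij]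

theorem HoldsData.of_appends (h : HoldsData bs i σ) (happ : Appends l σ σ') : HoldsData bs i σ' :=
  h.congr (happ.reg_eq 5 (by decide) (by decide)) happ.arr_eq

theorem haltsWithin_backwardStep (h : HoldsData bs (i + 1) σ) (hi : i < bs.length)
    (hpos : σ.reg 0 = 1 + 8 * (i + 1)) (hout : Outputs σ l) :
    HaltsWithin backwardStep σ 77 fun σ' =>
      HoldsData bs i σ' ∧ σ'.reg 0 = 1 + 8 * i ∧ Outputs σ' l := by
  refine ⟨_, _, by simp [Expr.cost, fstWord, sndWord], .seq (.set ..) (.seq (.put ..)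
    (.seq (.put ..) (.seq (.put ..) (.put ..)))), ?_⟩
  have hsub : 1 + 8 * (i + 1) - 8 = 1 + 8 * i := by omega
  simp only [Expr.eval, fstWord, sndWord, hpos, hsub, h.fst i hi, h.snd i hi, h.dist, ne_eq,
    Function.update_self, Function.update_of_ne, Function.update_idem, Nat.reduceEqDiff,
    OfNat.zero_ne_ofNat, not_false_eq_true]
  refine ⟨⟨h.modes, h.fst, h.snd, h.gate, h.size, fun a => ?_, fun j hj hij => ?_,
    fun j hj hij => ?_⟩, trivial, hout⟩
  · rw [List.drop_eq_getElem_cons hi, outDist]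
    simp only [Function.update_self, Function.update_apply, Fin.val_inj, h.dist]
    grind
  · rcases hij.eq_or_lt with rfl | hlt
    · simp
    · simpa [hlt.ne'] using h.fstSurplus j hj hlt
  · rcases hij.eq_or_lt with rfl | hlt
    · simp
    · simpa [hlt.ne'] using h.sndSurplus j hj hlt

theorem holdsData_initialStore (bs : List (Beamsplitter m)) :
    HoldsData bs bs.length { initialStore (describe (lossyNetwork bs)) with
      reg := Function.update (initialStore (describe (lossyNetwork bs))).reg 5
        (1 + 8 * bs.length) } where
  modes := rfl
  fst _ hj := getD_describe_lossyNetwork hj (by decide)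
  snd _ hj := getD_describe_lossyNetwork hj (by decide)
  gate _ hj := getD_describe_lossyNetwork hj (by decide)
  size := rfl
  dist a := by rw [List.drop_length]; rfl
  fstSurplus _ hj h := absurd hj h.not_gt
  sndSurplus _ hj h := absurd hj h.not_gt

theorem haltsWithin_backwardPass (bs : List (Beamsplitter m)) :
    HaltsWithin backwardPass (initialStore (describe (lossyNetwork bs))) (bs.length * 80 + 5)
      fun σ => HoldsData bs 0 σ ∧ σ.reg 0 = 1 ∧ Outputs σ [] := by
  let I (k : ℕ) (σ : Store) : Prop :=
    HoldsData bs (bs.length - k) σ ∧ σ.reg 0 = 1 + 8 * (bs.length - k) ∧ Outputs σ []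
  have hstep : ∀ k < bs.length, ∀ σ, I k σ → (Expr.const 1).eval σ < (Expr.var 0).eval σ ∧
      HaltsWithin backwardStep σ 77 (I (k + 1)) := by
    rintro k hk σ ⟨hdata, hpos, hout⟩
    obtain ⟨i, hi⟩ : ∃ i, bs.length - k = i + 1 := ⟨bs.length - k - 1, by omega⟩
    have hi' : bs.length - (k + 1) = i := by omega
    rw [hi] at hdata hpos
    simp only [I, hi']
    exact ⟨by simp only [Expr.eval, hpos]; omega,
      haltsWithin_backwardStep hdata (by omega) hpos hout⟩
  refine ((haltsWithin_set 5 (.var 0) _).seq fun σ hσ => haltsWithin_loop I hstep ?_ ?_).mono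
    (by simp only [Expr.cost]; omega) ?_
  · rintro σ ⟨-, hpos, -⟩
    simp [Expr.eval, hpos]
  · have hsize : (Expr.var 0).eval (initialStore (describe (lossyNetwork bs))) =
        1 + 8 * bs.length := length_describe_lossyNetwork bs
    subst hσ
    rw [hsize]
    exact ⟨holdsData_initialStore bs, hsize, rfl, by simp⟩
  · rintro σ ⟨hdata, hpos, hout⟩
    rw [Nat.sub_self] at hdata hpos
    exact ⟨hdata, hpos, hout⟩

theorem haltsWithin_minimumPass (h : HoldsData bs 0 σ) (hs : IsLeast (Set.range (outDist bs)) s)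
    (hout : Outputs σ l) :
    HaltsWithin minimumPass σ (m * 20 + 9) fun σ' =>
      HoldsData bs 0 σ' ∧ σ'.reg 0 = σ.reg 0 ∧ Outputs σ' l ∧ σ'.reg 2 = s := by
  obtain ⟨a₀, ha₀⟩ := hs.1
  let I (k : ℕ) (τ : Store) : Prop := HoldsData bs 0 τ ∧ τ.reg 0 = σ.reg 0 ∧ Outputs τ l ∧
    τ.reg 3 = k ∧ s ≤ τ.reg 2 ∧ ∀ a : Fin m, a < k → τ.reg 2 ≤ outDist bs a
  have hstep : ∀ k < m, ∀ τ, I k τ →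
      (Expr.var 3).eval τ < (Expr.get 0 (.const 0)).eval τ ∧
        HaltsWithin minimumStep τ 16 (I (k + 1)) := by
    rintro k hk τ ⟨hdata, hpos, hout, hmode, hlow, hle⟩
    have hdist : τ.arr 2 k = outDist bs ⟨k, hk⟩ := hdata.dist ⟨k, hk⟩
    have hsk : s ≤ outDist bs ⟨k, hk⟩ := hs.2 ⟨_, rfl⟩
    refine ⟨by simpa [Expr.eval, hdata.modes, hmode] using hk, _, _, by simp [Expr.cost],
      .seq (.set ..) (.set ..), hdata.congr rfl fun _ _ => rfl, hpos, hout, ?_, ?_, fun a ha => ?_⟩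
    · simp [Expr.eval, hmode]
    · change s ≤ τ.reg 2 - (τ.reg 2 - τ.arr 2 (τ.reg 3))
      rw [hmode, hdist]
      omega
    · change τ.reg 2 - (τ.reg 2 - τ.arr 2 (τ.reg 3)) ≤ outDist bs a
      rw [hmode, hdist]
      rcases Nat.lt_succ_iff_lt_or_eq.1 ha with ha | rfl
      · exact (Nat.sub_le _ _).trans (hle a ha)
      · exact tsub_tsub_le
  refine ((haltsWithin_set 2 _ σ).seq fun τ₁ h₁ => (haltsWithin_set 3 _ τ₁).seq fun τ₂ h₂ =>
    haltsWithin_loop I hstep ?_ ?_).mono (by simp only [Expr.cost]; omega) ?_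
  · rintro τ ⟨hdata, -, -, hmode, -⟩
    simp [Expr.eval, hdata.modes, hmode]
  · subst h₁ h₂
    refine ⟨h.congr rfl fun _ _ => rfl, rfl, hout, rfl, ?_, fun a ha => absurd ha (by simp)⟩
    simpa [Expr.eval] using (hs.2 ⟨⟨0, a₀.pos⟩, rfl⟩).trans_eq (h.dist ⟨0, a₀.pos⟩).symm
  · rintro τ ⟨hdata, hpos, hout, -, hlow, hle⟩
    exact ⟨hdata, hpos, hout, ((hle a₀ a₀.2).trans_eq ha₀).antisymm hlow⟩

theorem haltsWithin_inputStep (h : HoldsData bs 0 σ) {a : Fin m} (hlayers : σ.reg 2 = s)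
    (hmode : σ.reg 3 = a) (hout : Outputs σ l) :
    HaltsWithin inputStep σ (bs.length * 21 + 12) fun σ' =>
      HoldsData bs 0 σ' ∧ σ'.reg 0 = σ.reg 0 ∧ σ'.reg 2 = s ∧ σ'.reg 3 = a + 1 ∧
        Outputs σ' (l ++ (List.replicate (outDist bs a - s) [0, (a : ℕ)]).flatten) := by
  have hwrites := writes_emitLosses (n := .sub (.get 2 (.var 3)) (.var 2)) (e := .var 3)
    (by simp [Expr.Stable]) (by simp [Expr.Stable]) σ
  simp only [Expr.eval, Expr.cost, hmode, hlayers, h.dist] at hwrites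
  refine (hwrites.haltsWithin.seq fun σ₁ h₁ => (haltsWithin_set 3 _ σ₁).mono le_rfl
    fun σ₂ h₂ => ?_).mono ?_ fun _ => id
  · have hreg (r : ℕ) (hr : r ≠ 1) (hr' : r ≠ 4) : σ₁.reg r = σ.reg r := h₁.reg_eq r hr hr'
    subst h₂
    refine ⟨(h.of_appends h₁).congr rfl fun _ _ => rfl, hreg 0 (by decide) (by decide),
      (hreg 2 (by decide) (by decide)).trans hlayers, ?_, h₁.outputs hout⟩
    simp [Expr.eval, hreg 3, hmode]
  · have := outDist_le_length bs a
    simp only [Expr.cost]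
    rw [List.drop_zero]
    omega

theorem haltsWithin_inputPass (h : HoldsData bs 0 σ) (hlayers : σ.reg 2 = s)
    (hout : Outputs σ l) :
    HaltsWithin inputPass σ (m * (bs.length * 21 + 16) + 14) fun σ' =>
      HoldsData bs 0 σ' ∧ σ'.reg 0 = σ.reg 0 ∧
        Outputs σ' (l ++ m :: (List.finRange m).flatMap fun a =>
          (List.replicate (outDist bs a - s) [0, (a : ℕ)]).flatten) := by
  let words (a : Fin m) : List ℕ := (List.replicate (outDist bs a - s) [0, (a : ℕ)]).flatten
  let I (k : ℕ) (τ : Store) : Prop := HoldsData bs 0 τ ∧ τ.reg 0 = σ.reg 0 ∧ τ.reg 2 = s ∧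
    τ.reg 3 = k ∧ Outputs τ (l ++ m :: ((List.finRange m).take k).flatMap words)
  have hstep : ∀ k < m, ∀ τ, I k τ →
      (Expr.var 3).eval τ < (Expr.get 0 (.const 0)).eval τ ∧
        HaltsWithin inputStep τ (bs.length * 21 + 12) (I (k + 1)) := by
    rintro k hk τ ⟨hdata, hpos, hlayers, hmode, hout⟩
    refine ⟨by simpa [Expr.eval, hdata.modes, hmode] using hk,
      (haltsWithin_inputStep hdata (a := ⟨k, hk⟩) hlayers hmode hout).mono le_rfl ?_⟩
    rintro τ' ⟨hdata', hpos', hlayers', hmode', hout'⟩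
    exact ⟨hdata', hpos'.trans hpos, hlayers', hmode',
      by simpa [List.take_add_one, hk, words] using hout'⟩
  refine ((haltsWithin_emit _ σ).seq fun τ₁ h₁ => (haltsWithin_set 3 _ τ₁).seq fun τ₂ h₂ =>
    haltsWithin_loop I hstep ?_ ?_).mono ?_ ?_
  · rintro τ ⟨hdata, -, -, hmode, -⟩
    simp [Expr.eval, hdata.modes, hmode]
  · subst h₂
    refine ⟨(h.of_appends h₁.1).congr rfl fun _ _ => rfl, h₁.1.reg_eq 0 (by decide) (by decide),
      (h₁.1.reg_eq 2 (by decide) (by decide)).trans hlayers, rfl, ?_⟩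
    have := h₁.1.outputs hout
    rwa [Expr.eval, Expr.eval, h.modes] at this
  · simp only [Expr.cost]
    ring_nf
    omega
  · rintro τ ⟨hdata, hpos, -, -, hout⟩
    rw [List.take_of_length_le (List.length_finRange.le)] at hout
    exact ⟨hdata, hpos, hout⟩

theorem writes_writeBlock (h : HoldsData bs 0 σ) (hi : i < bs.length)
    (hpos : σ.reg 0 = 1 + 8 * i) :
    Writes σ writeBlock ([1, (bs[i].fst : ℕ), (bs[i].snd : ℕ), bs[i].gate] ++
      ((List.replicate (outDist (bs.drop (i + 1)) bs[i].fst - outDist (bs.drop (i + 1)) bs[i].snd)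
          [0, (bs[i].fst : ℕ)]).flatten ++
        (List.replicate (outDist (bs.drop (i + 1)) bs[i].snd - outDist (bs.drop (i + 1)) bs[i].fst)
          [0, (bs[i].snd : ℕ)]).flatten)) (bs.length * 24 + 49) := by
  have hfst : fstWord.Stable := by simp [fstWord, Expr.Stable]
  have hsnd : sndWord.Stable := by simp [sndWord, Expr.Stable]
  have hgate : gateWord.Stable := by simp [gateWord, Expr.Stable]
  have hwrites := ((writes_emit (e := .const 1) trivial σ).seq ((writes_emit hfst σ).seq
    ((writes_emit hsnd σ).seq (writes_emit hgate σ)))).seq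
      ((writes_emitLosses (n := .get 3 (.var 0)) (by simp [Expr.Stable]) hfst σ).seq
        (writes_emitLosses (n := .get 4 (.var 0)) (by simp [Expr.Stable]) hsnd σ))
  simp only [fstWord, sndWord, gateWord, Expr.eval, Expr.cost, hpos, h.fst i hi, h.snd i hi,
    h.gate i hi, h.fstSurplus i hi i.zero_le, h.sndSurplus i hi i.zero_le] at hwrites
  refine hwrites.mono ?_
  have hle (a : Fin m) := outDist_le_length (bs.drop (i + 1)) a
  have := hle bs[i].fst
  have := hle bs[i].snd
  simp only [List.length_drop] at *
  omega

theorem haltsWithin_forwardPass (h : HoldsData bs 0 σ) (hpos : σ.reg 0 = 1) (hout : Outputs σ l) :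
    HaltsWithin forwardPass σ (bs.length * (bs.length * 24 + 56) + 3) fun σ' =>
      Outputs σ' (l ++ (lossyCore bs).flatMap Component.words) := by
  let I (k : ℕ) (τ : Store) : Prop := HoldsData bs 0 τ ∧ τ.reg 0 = 1 + 8 * k ∧
    ∃ l', Outputs τ l' ∧ l' ++ (lossyCore (bs.drop k)).flatMap Component.words =
      l ++ (lossyCore bs).flatMap Component.words
  have hstep : ∀ k < bs.length, ∀ τ, I k τ → (Expr.var 0).eval τ < (Expr.var 5).eval τ ∧
      HaltsWithin forwardStep τ (bs.length * 24 + 53) (I (k + 1)) := by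
    rintro k hk τ ⟨hdata, hpos, l', hout, hl'⟩
    refine ⟨by simp only [Expr.eval, hdata.size, hpos]; omega,
      ((writes_writeBlock hdata hk hpos).haltsWithin.seq fun τ₁ h₁ =>
        (haltsWithin_set 0 _ τ₁).mono le_rfl fun τ₂ h₂ => ?_).mono
          (by simp only [Expr.cost]; omega) fun _ => id⟩
    subst h₂
    refine ⟨(hdata.of_appends h₁).congr rfl fun _ _ => rfl, ?_, _, h₁.outputs hout, ?_⟩
    · simp [Expr.eval, h₁.reg_eq 0, hpos, mul_add, add_assoc]
    · rw [← hl', List.drop_eq_getElem_cons hk, words_lossyCore_cons]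
      simp
  refine (haltsWithin_loop I hstep ?_ ⟨h, hpos, l, hout, rfl⟩).mono
    (by simp only [Expr.cost]; ring_nf; omega) ?_
  · rintro τ ⟨hdata, hpos, -⟩
    simp [Expr.eval, hdata.size, hpos]
  · rintro τ ⟨-, -, l', hout, hl'⟩
    rw [← hl', List.drop_length]
    simpa [lossyCore] using hout

theorem pullOutProgram_computesWithin (hs : IsLeast (Set.range (outDist bs)) s) :
    ComputesWithin pullOutProgram (describe (lossyNetwork bs)) (describe (reducedNetwork bs s))
      (100 * (m + (lossyNetwork bs).length + 1) ^ 2) := by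
  have hlength : (lossyNetwork bs).length = 3 * bs.length := by
    simp [lossyNetwork, block, List.length_flatMap, mul_comm]
  rw [describe_reducedNetwork, hlength]
  obtain ⟨σ, t, ht, hrun, hlen, hget⟩ := (haltsWithin_backwardPass bs).seq
    fun σ₁ ⟨hdata₁, hpos₁, hout₁⟩ => (haltsWithin_minimumPass hdata₁ hs hout₁).seq
      fun σ₂ ⟨hdata₂, hpos₂, hout₂, hlayers⟩ => (haltsWithin_inputPass hdata₂ hlayers hout₂).seq
        fun σ₃ ⟨hdata₃, hpos₃, hout₃⟩ =>
          haltsWithin_forwardPass hdata₃ (hpos₃.trans (hpos₂.trans hpos₁)) hout₃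
  exact ⟨σ, t, ht.trans (by nlinarith [Nat.zero_le (m * bs.length)]), hrun, hlen, hget⟩

end Algorithm

end LossyOptics

/-- One fixed program computes, in time polynomial in the number of modes and the number of components,
for every network `N` constructed out of lossy building blocks a network `N'` that is left over when `s`
uniform layers of losses (hence `s * m` loss elements) are pulled out of `N`, where `s` is the smallest
number of beamsplitters on a path from an input to an output; and `Λ_N = Λ_{N'} ∘ Λ_{η^s}`
for every choice of the unitaries and of the transmissivity. -/
theorem theorem2 :
    ∃ (P : LossyOptics.Program) (T : Polynomial ℕ),
      ∀ (m : ℕ) (bs : List (LossyOptics.Beamsplitter m)) (s : ℕ),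
        IsLeast {k : ℕ | ∃ a b : Fin m,
          LossyOptics.PathCrosses (LossyOptics.lossyNetwork bs) a b k} s →
        ∃ N' : LossyOptics.Network m,
          LossyOptics.PullsOut (LossyOptics.lossyNetwork bs) s N' ∧
          LossyOptics.beamsplitters N' = bs ∧
          LossyOptics.lossCount N' + s * m =
            LossyOptics.lossCount (LossyOptics.lossyNetwork bs) ∧
          LossyOptics.ComputesWithin P
            (LossyOptics.describe (LossyOptics.lossyNetwork bs)) (LossyOptics.describe N')
            (T.eval (m + (LossyOptics.lossyNetwork bs).length)) ∧
          ∀ (U : ℕ → Matrix.unitaryGroup (Fin 2) ℂ) (η : ℝ), 0 ≤ η → η ≤ 1 →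
            ∀ ρ : LossyOptics.FockOp m, LossyOptics.IsState ρ →
              LossyOptics.networkChannel U η (LossyOptics.lossyNetwork bs) ρ =
                LossyOptics.networkChannel U η N' (LossyOptics.uniformLoss (η ^ s) ρ) := by
  refine ⟨LossyOptics.pullOutProgram, 100 * (Polynomial.X + 1) ^ 2, fun m bs s hs => ?_⟩
  have hdist := LossyOptics.isLeast_range_outDist hs
  have hpull := LossyOptics.pullsOut_reducedNetwork fun a => hdist.2 ⟨a, rfl⟩
  refine ⟨LossyOptics.reducedNetwork bs s, hpull,
    hpull.beamsplitters_eq.symm.trans (LossyOptics.beamsplitters_lossyNetwork bs),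
    hpull.lossCount_eq.symm, ?_, fun U η h0 h1 ρ hρ =>
      hpull.networkChannel_eq U h0 h1 hρ.isTraceClass⟩
  simpa using LossyOptics.pullOutProgram_computesWithin hdist
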